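/- **Theorem (Sample complexity of SOTRGS).** Let $n\ge 2$, let $\xi$ be a random sample with law $\mathcal P$, and let $f(\cdot;\xi):\mathbb R^n\to\mathbb R$ be twice differentiable stochastic component functions of an objective $F:\mathbb R^n\to\mathbb R$ that is bounded below. Let $\|\cdot\|$ be the Euclidean norm of vectors and the spectral norm of matrices, let $\lambda_{\min}$ be the smallest eigenvalue, fix $x_0\in\mathbb R^n$ and put $\Delta_F=F(x_0)-\inf F>0$. Suppose that there are constants $L_0,M_0,\delta>0$ and $L_1,M_1,G_0,G_1,K_0,K_1\ge 0$ such that for all $x,x'\in\mathbb R^n$: 1. $F$ is differentiable, and $\|\nabla F(x)-\nabla F(x')\|\le (L_0+L_1\|\nabla F(x)\|)\|x-x'\|$ whenever $\|x-x'\|\le 1/L_1$; 2. $\mathbb E_\xi[\nabla f(x;\xi)]=\nabla F(x)$ and $\mathbb E_\xi\|\nabla f(x;\xi)-\nabla F(x)\|^2\le G_0^2+G_1^2\|\nabla F(x)\|^2$; 3. $F$ is twice differentiable, $\|\nabla^2F(x)-\nabla^2F(x')\|\le (M_0+M_1\|\nabla F(x)\|)\|x-x'\|$ whenever $\|x-x'\|\le\delta$,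 and $\mathbb E_\xi[\nabla^2 f(x;\xi)]=\nabla^2F(x)$, $\mathbb E_\xi\|\nabla^2 f(x;\xi)-\nabla^2F(x)\|^2\le K_0^2+K_1^2\|\nabla F(x)\|^2$. Let $0<\epsilon<\min\left\{\frac{3}{5M_1+18G_1+12K_1},\frac1{L_1^2}\right\}$ (with $1/0=+\infty$ here and in 1.), let $c>0$ and $T=\lceil c\,\Delta_F\,\epsilon^{-3/2}\rceil$. Run the second-order trust region method from $x_0$: in each iteration $t=0,\dots,T-1$ draw fresh independent batches $\mathcal S_1,\mathcal S_2$ of i.i.d. samples of law $\mathcal P$ with $|\mathcal S_1|=\lceil\epsilon^{-2}\rceil$ and $|\mathcal S_2|=\lceil 22\log(n)\,\epsilon^{-1}\rceil$, set $g_t=\frac1{|\mathcal S_1|}\sum_{\xi\in\mathcal S_1}\nabla f(x_t;\xi)$ and $H_t=\frac1{|\mathcal S_2|}\sum_{\xi\in\mathcal S_2}\nabla^2 f(x_t;\xi)$, let $d_{t+1}$ be a (measurably chosen) global minimizer of $F(x_t)+g_t^Td+\frac12d^TH_td$ over $\|d\|\le\sqrt\epsilon$, and set $x_{t+1}=x_t+d_{t+1}$.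 Let $\bar t$ be uniformly distributed on $\{0,\dots,T-1\}$, independently of the iterates. Then there is a constant $C>0$ that depends only on $L_0,L_1,M_0,M_1,G_0,G_1,K_0,K_1$ and $c$ such that $$\mathbb E\|\nabla F(x_{\bar t+1})\|\le C\epsilon,\qquad \mathbb E\big[\lambda_{\min}(\nabla^2F(x_{\bar t+1}))\big]\ge -C\sqrt\epsilon ,$$ i.e. $x_{\bar t+1}$ is in expectation an $(\epsilon,\sqrt\epsilon)$-second-order stationary point. Moreover, if $\epsilon\le1$ and $\epsilon^{3/2}\le c\,\Delta_F$, then the total number of samples drawn satisfies $$T\,(|\mathcal S_1|+|\mathcal S_2|)\le C\left(\frac{\Delta_F}{\epsilon^{7/2}}+\log (n)\,\frac{\Delta_F}{\epsilon^{5/2}}\right),$$ which is $\mathcal O(\Delta_F\epsilon^{-7/2}+\Delta_F\epsilon^{-5/2})$ for fixed $n$. -/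

import Mathlib

open MeasureTheory ProbabilityTheory

noncomputable section

/-- `ℝⁿ` with the Euclidean norm. -/
abbrev Vec (n : ℕ) : Type := EuclideanSpace ℝ (Fin n)

/-- The Hessian `∇²F(x)` as a linear operator on `ℝⁿ`, i.e. the derivative of the gradient.
Its operator norm is the spectral norm of the Hessian matrix. -/
def hessian {n : ℕ} (F : Vec n → ℝ) (x : Vec n) : Vec n →L[ℝ] Vec n :=
  fderiv ℝ (gradient F) x

/-- The smallest (real) eigenvalue. -/
def lambdaMin {n : ℕ} (A : Vec n →L[ℝ] Vec n) : ℝ :=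
  sInf {μ : ℝ | Module.End.HasEigenvalue (A : Vec n →ₗ[ℝ] Vec n) μ}

def TwiceDifferentiable {n : ℕ} (F : Vec n → ℝ) : Prop :=
  Differentiable ℝ F ∧ Differentiable ℝ (gradient F)

/-- `(L₀, L₁)`-smoothness. The range `‖x - x'‖ ≤ 1 / L₁` is written `L₁ ‖x - x'‖ ≤ 1`, so that
there is no restriction when `L₁ = 0`. -/
def GeneralizedSmooth {n : ℕ} (F : Vec n → ℝ) (L₀ L₁ : ℝ) : Prop :=
  Differentiable ℝ F ∧
    ∀ x x' : Vec n, L₁ * ‖x - x'‖ ≤ 1 →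
      ‖gradient F x - gradient F x'‖ ≤ (L₀ + L₁ * ‖gradient F x‖) * ‖x - x'‖

/-- Second-order generalized smoothness with constants `M₀, M₁` on pairs at distance at most `δ`. -/
def SecondOrderGeneralizedSmooth {n : ℕ} (F : Vec n → ℝ) (δ M₀ M₁ : ℝ) : Prop :=
  TwiceDifferentiable F ∧
    ∀ x x' : Vec n, ‖x - x'‖ ≤ δ →
      ‖hessian F x - hessian F x'‖ ≤ (M₀ + M₁ * ‖gradient F x‖) * ‖x - x'‖

/-- A stochastic component function `f(x; ξ)`: measurable in the sample and twice differentiable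
in `x`. -/
def StochasticComponent {n : ℕ} {Ξ : Type*} [MeasurableSpace Ξ] (f : Vec n → Ξ → ℝ) : Prop :=
  (∀ x, Measurable (f x)) ∧ ∀ ξ, TwiceDifferentiable (fun x => f x ξ)

/-- The stochastic gradient is unbiased and `(G₀, G₁)`-variance-bounded. -/
def GradientVarianceBounded {n : ℕ} {Ξ : Type*} [MeasurableSpace Ξ] (D : Measure Ξ)
    (f : Vec n → Ξ → ℝ) (F : Vec n → ℝ) (G₀ G₁ : ℝ) : Prop :=
  ∀ x : Vec n,
    Integrable (fun ξ => gradient (fun y => f y ξ) x) D ∧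
    ∫ ξ, gradient (fun y => f y ξ) x ∂D = gradient F x ∧
    Integrable (fun ξ => ‖gradient (fun y => f y ξ) x - gradient F x‖ ^ 2) D ∧
    ∫ ξ, ‖gradient (fun y => f y ξ) x - gradient F x‖ ^ 2 ∂D
      ≤ G₀ ^ 2 + G₁ ^ 2 * ‖gradient F x‖ ^ 2

/-- The stochastic Hessian is unbiased and `(K₀, K₁)`-variance-bounded. -/
def HessianVarianceBounded {n : ℕ} {Ξ : Type*} [MeasurableSpace Ξ] (D : Measure Ξ)
    (f : Vec n → Ξ → ℝ) (F : Vec n → ℝ) (K₀ K₁ : ℝ) : Prop :=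
  ∀ x : Vec n,
    Integrable (fun ξ => hessian (fun y => f y ξ) x) D ∧
    ∫ ξ, hessian (fun y => f y ξ) x ∂D = hessian F x ∧
    Integrable (fun ξ => ‖hessian (fun y => f y ξ) x - hessian F x‖ ^ 2) D ∧
    ∫ ξ, ‖hessian (fun y => f y ξ) x - hessian F x‖ ^ 2 ∂D
      ≤ K₀ ^ 2 + K₁ ^ 2 * ‖gradient F x‖ ^ 2

/-- The initial gap `Δ_F = F(x₀) - inf F`. -/
def initialGap {n : ℕ} (F : Vec n → ℝ) (x₀ : Vec n) : ℝ := F x₀ - ⨅ x, F x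

/-- The batch function `f(x; S) = (1/|S|) ∑_{ξ ∈ S} f(x; ξ)`, the batch being a finite family. -/
def batch {n m : ℕ} {Ξ : Type*} (f : Vec n → Ξ → ℝ) (S : Fin m → Ξ) (x : Vec n) : ℝ :=
  (1 / (m : ℝ)) * ∑ i, f x (S i)

/-- The quadratic model `m(d) = F(x) + gᵀ d + (1/2) dᵀ B d`. -/
def trModel {n : ℕ} (c : ℝ) (g : Vec n) (B : Vec n →L[ℝ] Vec n) (d : Vec n) : ℝ :=
  c + inner ℝ g d + (1 / 2) * inner ℝ d (B d)

/-- `d` is a global solution of the trust region subproblem of radius `Δ`. -/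
def IsTRSolution {n : ℕ} (c : ℝ) (g : Vec n) (B : Vec n →L[ℝ] Vec n) (Δ : ℝ) (d : Vec n) : Prop :=
  ‖d‖ ≤ Δ ∧ ∀ d' : Vec n, ‖d'‖ ≤ Δ → trModel c g B d ≤ trModel c g B d'

/-- The samples drawn in one iteration: `m₁` for the gradient and `m₂` for the Hessian. -/
abbrev IterSample (m₁ m₂ : ℕ) : Type := Fin m₁ ⊕ Fin m₂

/-- The number of samples drawn in a run of `T` iterations. -/
def sampleCount (T m₁ m₂ : ℕ) : ℕ := Fintype.card (Fin T × IterSample m₁ m₂)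

/-- A run of `T` iterations of the second-order trust region method (`B_t = H_t`) of constant
radius `Δ`, started at `x₀`, on a probability space `(Ω, P)`. `S t i` is the `i`-th sample drawn in
iteration `t`, `X t` is the iterate `x_t`, and `ℱ t` is the information available before iteration
`t`: the samples of iteration `t` are i.i.d. with law `D`, independent of `ℱ t`, and known at time
`t + 1`. Which global solution of the subproblem is taken is left open, as long as the
choice is a random variable that does not anticipate later samples. -/
structure IsSOTRGSRun {n : ℕ} {Ξ Ω : Type*} [MeasurableSpace Ξ] [mΩ : MeasurableSpace Ω]
    (P : Measure Ω) (D : Measure Ξ) (f : Vec n → Ξ → ℝ) (F : Vec n → ℝ) (x₀ : Vec n) (Δ : ℝ)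
    (T m₁ m₂ : ℕ) (ℱ : Filtration (Fin (T + 1)) mΩ)
    (S : Fin T → IterSample m₁ m₂ → Ω → Ξ) (X : Fin (T + 1) → Ω → Vec n) : Prop where
  sample_known : ∀ t i, Measurable[ℱ t.succ] (S t i)
  sample_law : ∀ t i, P.map (S t i) = D
  sample_iIndep : ∀ t, iIndepFun (S t) P
  sample_fresh : ∀ t : Fin T,
    Indep (ℱ t.castSucc) (MeasurableSpace.comap (fun ω i => S t i ω) inferInstance) P
  iterate_known : ∀ t, Measurable[ℱ t] (X t)
  init : ∀ ω, X 0 ω = x₀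
  step : ∀ (t : Fin T) (ω : Ω), ∃ d : Vec n,
    IsTRSolution (F (X t.castSucc ω))
      (gradient (batch f (fun i => S t (Sum.inl i) ω)) (X t.castSucc ω))
      (hessian (batch f (fun i => S t (Sum.inr i) ω)) (X t.castSucc ω)) Δ d ∧
    X t.succ ω = X t.castSucc ω + d

/-- `τ` is uniformly distributed on `{0, …, T - 1}` and independent of the iterates `X`. -/
def IsUniformIndex {n T : ℕ} {Ω : Type*} [MeasurableSpace Ω] (P : Measure Ω)
    (X : Fin (T + 1) → Ω → Vec n) (τ : Ω → Fin T) : Prop :=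
  Measurable τ ∧ (∀ k, P {ω | τ ω = k} = (T : ENNReal)⁻¹) ∧ IndepFun τ (fun ω t => X t ω) P

end

/-!
Comparing the minimizer of the quadratic model with the Taylor expansion of `F` gives, on a step of
length at most `r = √ε`, a decrease of `F` by a multiple of `r ‖∇F‖` and of `-r² λ_min(∇²F)` at the
new point, up to errors `r ‖g - ∇F‖`, `r² ‖H - ∇²F‖` and `r³ (M₀ + M₁ ‖∇F‖)` at the old one. The
batch sizes make the first two errors `O(r³ (1 + ‖∇F‖))` in expectation. For the gradient this is
the variance of a mean of independent vectors; for the Hessian in spectral norm it is a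
noncommutative Khintchine inequality, obtained by symmetrization and traces of even powers, which
is the source of the factor `log n`. Summing over the run, the decrease of `F` telescopes, and
`ε` is so small that the error terms proportional to `‖∇F‖` are absorbed by the left-hand side.
-/

/-! ### Traces of powers of symmetric operators -/

section Spectral

open LinearMap (trace)
open Finset.HasAntidiagonal (antidiagonal)

variable {E : Type*} [NormedAddCommGroup E] [InnerProductSpace ℝ E] [FiniteDimensional ℝ E]
  {n : ℕ} {A B H : E →ₗ[ℝ] E}

theorem pow_apply_eigenvectorBasis (hA : A.IsSymmetric) (hn : Module.finrank ℝ E = n) (q : ℕ)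
    (i : Fin n) :
    (A ^ q) (hA.eigenvectorBasis hn i) =
      hA.eigenvalues hn i ^ q • hA.eigenvectorBasis hn i := by
  induction q with
  | zero => simp
  | succ q ih =>
    rw [pow_succ', Module.End.mul_apply, ih, map_smul, hA.apply_eigenvectorBasis hn i, smul_smul,
      pow_succ, RCLike.ofReal_real_eq_id, id]

theorem inner_pow_apply_self (hA : A.IsSymmetric) (hn : Module.finrank ℝ E = n) (q : ℕ) (x : E) :
    inner ℝ x ((A ^ q) x) =
      ∑ i, hA.eigenvalues hn i ^ q * inner ℝ (hA.eigenvectorBasis hn i) x ^ 2 := by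
  rw [← (hA.eigenvectorBasis hn).sum_inner_mul_inner x ((A ^ q) x)]
  refine Finset.sum_congr rfl fun i _ => ?_
  rw [← (hA.pow q) (hA.eigenvectorBasis hn i) x, pow_apply_eigenvectorBasis hA hn,
    real_inner_smul_left, real_inner_comm x]
  ring

theorem trace_pow_eq_sum_eigenvalues (hA : A.IsSymmetric) (hn : Module.finrank ℝ E = n) (q : ℕ) :
    trace ℝ E (A ^ q) = ∑ i, hA.eigenvalues hn i ^ q := by
  rw [LinearMap.trace_eq_sum_inner _ (hA.eigenvectorBasis hn)]
  refine Finset.sum_congr rfl fun i _ => ?_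
  rw [pow_apply_eigenvectorBasis hA hn, real_inner_smul_right, real_inner_self_eq_norm_sq,
    (hA.eigenvectorBasis hn).norm_eq_one, one_pow, mul_one]

theorem trace_pow_mul_pow_mul (hA : A.IsSymmetric) (hB : B.IsSymmetric) (hH : H.IsSymmetric)
    (hn : Module.finrank ℝ E = n) (q k : ℕ) :
    trace ℝ E (A ^ q * H * B ^ k * H) =
      ∑ i, ∑ j, hA.eigenvalues hn i ^ q * hB.eigenvalues hn j ^ k *
        inner ℝ (hB.eigenvectorBasis hn j) (H (hA.eigenvectorBasis hn i)) ^ 2 := by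
  rw [LinearMap.trace_eq_sum_inner _ (hA.eigenvectorBasis hn)]
  refine Finset.sum_congr rfl fun i _ => ?_
  simp only [Module.End.mul_apply]
  rw [← (hA.pow q), pow_apply_eigenvectorBasis hA hn, real_inner_smul_left, ← hH,
    inner_pow_apply_self hB hn, Finset.mul_sum]
  exact Finset.sum_congr rfl fun j _ => (mul_assoc _ _ _).symm

theorem pow_mul_pow_add_le_of_even {a b : ℝ} {q k : ℕ} (hqk : Even (q + k)) :
    a ^ q * b ^ k + a ^ k * b ^ q ≤ a ^ (q + k) + b ^ (q + k) := by
  suffices 0 ≤ (a ^ q - b ^ q) * (a ^ k - b ^ k) by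
    rw [pow_add, pow_add]
    linarith
  have mono : ∀ {m : ℕ}, Odd m → Monotone fun x : ℝ => x ^ m := fun hm => hm.strictMono_pow.monotone
  rcases Nat.even_or_odd q with hq | hq
  · have hk : Even k := (Nat.even_add.1 hqk).1 hq
    rw [← hq.pow_abs a, ← hq.pow_abs b, ← hk.pow_abs a, ← hk.pow_abs b]
    rcases le_total |a| |b| with h | h
    · exact mul_nonneg_of_nonpos_of_nonpos (sub_nonpos.2 (by gcongr)) (sub_nonpos.2 (by gcongr))
    · exact mul_nonneg (sub_nonneg.2 (by gcongr)) (sub_nonneg.2 (by gcongr))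
  · have hk : Odd k := by grind
    rcases le_total a b with h | h
    · exact mul_nonneg_of_nonpos_of_nonpos (sub_nonpos.2 (mono hq h)) (sub_nonpos.2 (mono hk h))
    · exact mul_nonneg (sub_nonneg.2 (mono hq h)) (sub_nonneg.2 (mono hk h))

theorem trace_pow_mul_pow_mul_add_le (hA : A.IsSymmetric) (hB : B.IsSymmetric)
    (hH : H.IsSymmetric) {q k : ℕ} (hqk : Even (q + k)) :
    trace ℝ E (A ^ q * H * B ^ k * H) + trace ℝ E (A ^ k * H * B ^ q * H) ≤
      trace ℝ E (A ^ (q + k) * H * H) + trace ℝ E (B ^ (q + k) * H * H) := by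
  have hA_side := trace_pow_mul_pow_mul hA hB hH rfl (q + k) 0
  have hB_side := trace_pow_mul_pow_mul hA hB hH rfl 0 (q + k)
  rw [pow_zero, mul_one] at hA_side
  rw [pow_zero, one_mul, mul_assoc, LinearMap.trace_mul_comm] at hB_side
  rw [hA_side, hB_side, trace_pow_mul_pow_mul hA hB hH rfl, trace_pow_mul_pow_mul hA hB hH rfl]
  simp only [← Finset.sum_add_distrib, ← add_mul, pow_zero, mul_one, one_mul]
  exact Finset.sum_le_sum fun i _ => Finset.sum_le_sum fun j _ =>
    mul_le_mul_of_nonneg_right (pow_mul_pow_add_le_of_even hqk) (sq_nonneg _)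

theorem sum_antidiagonal_trace_le (hA : A.IsSymmetric) (hB : B.IsSymmetric) (hH : H.IsSymmetric)
    {N : ℕ} (hN : Even N) :
    2 * ∑ p ∈ antidiagonal N, trace ℝ E (A ^ p.1 * H * B ^ p.2 * H) ≤
      (N + 1) * (trace ℝ E (A ^ N * H * H) + trace ℝ E (B ^ N * H * H)) := by
  rw [two_mul]
  nth_rewrite 2 [← Finset.Nat.sum_antidiagonal_swap]
  rw [← Finset.sum_add_distrib]
  refine (Finset.sum_le_card_nsmul _ _ (trace ℝ E (A ^ N * H * H) + trace ℝ E (B ^ N * H * H))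
    fun p hp => ?_).trans_eq ?_
  · rw [← Finset.HasAntidiagonal.mem_antidiagonal.1 hp] at hN ⊢
    exact trace_pow_mul_pow_mul_add_le hA hB hH hN
  · rw [Finset.Nat.card_antidiagonal, nsmul_eq_mul, Nat.cast_add_one]

theorem pow_succ_sub_pow_succ {R : Type*} [Ring R] (a b : R) (N : ℕ) :
    a ^ (N + 1) - b ^ (N + 1) = ∑ p ∈ antidiagonal N, a ^ p.1 * (a - b) * b ^ p.2 := by
  induction N with
  | zero => simp
  | succ N ih =>
    rw [Finset.Nat.sum_antidiagonal_succ']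
    simp only [pow_succ b, pow_zero, ← mul_assoc, ← Finset.sum_mul, mul_one]
    rw [← ih, pow_succ a (N + 1), pow_succ b N]
    noncomm_ring

theorem trace_pow_succ_mul_sub_le (hA : A.IsSymmetric) (hB : B.IsSymmetric) (hH : H.IsSymmetric)
    (hAB : A - B = (2 : ℝ) • H) {N : ℕ} (hN : Even N) :
    trace ℝ E (A ^ (N + 1) * H) - trace ℝ E (B ^ (N + 1) * H) ≤
      (N + 1) * (trace ℝ E (A ^ N * H * H) + trace ℝ E (B ^ N * H * H)) := by
  refine le_trans (le_of_eq ?_) (sum_antidiagonal_trace_le hA hB hH hN)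
  rw [← map_sub, ← sub_mul, pow_succ_sub_pow_succ, hAB, Finset.sum_mul, map_sum, Finset.mul_sum]
  simp only [mul_smul_comm, smul_mul_assoc, map_smul, smul_eq_mul]

theorem trace_pow_mul_mul_self_le (hA : A.IsSymmetric) (hH : H.IsSymmetric) {N : ℕ} (hN : Even N)
    {c : ℝ} (hc : ∀ v, ‖H v‖ ≤ c * ‖v‖) :
    trace ℝ E (A ^ N * H * H) ≤ c ^ 2 * trace ℝ E (A ^ N) := by
  rw [trace_pow_eq_sum_eigenvalues hA rfl,
    LinearMap.trace_eq_sum_inner _ (hA.eigenvectorBasis rfl), Finset.mul_sum]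
  refine Finset.sum_le_sum fun i _ => ?_
  simp only [Module.End.mul_apply]
  rw [← (hA.pow N), pow_apply_eigenvectorBasis hA, real_inner_smul_left, ← hH,
    real_inner_self_eq_norm_sq, mul_comm]
  have hHi := hc (hA.eigenvectorBasis rfl i)
  rw [(hA.eigenvectorBasis rfl).norm_eq_one, mul_one] at hHi
  gcongr
  exact hN.pow_nonneg _

theorem opNorm_sq_le_of_eigenvalues_sq_le {A : E →L[ℝ] E} (hA : (A : E →ₗ[ℝ] E).IsSymmetric)
    (hn : Module.finrank ℝ E = n) {s : ℝ} (hs : 0 ≤ s) (h : ∀ i, hA.eigenvalues hn i ^ 2 ≤ s) :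
    ‖A‖ ^ 2 ≤ s := by
  suffices ‖A‖ ≤ √s from (Real.le_sqrt (norm_nonneg _) hs).1 this
  refine A.opNorm_le_bound (Real.sqrt_nonneg _) fun v => le_of_sq_le_sq ?_ (by positivity)
  calc ‖A v‖ ^ 2 = inner ℝ v (((A : E →ₗ[ℝ] E) ^ 2) v) := by
        rw [← real_inner_self_eq_norm_sq, pow_two, Module.End.mul_apply]
        exact hA v (A v)
    _ = ∑ i, hA.eigenvalues hn i ^ 2 * inner ℝ (hA.eigenvectorBasis hn i) v ^ 2 :=
        inner_pow_apply_self hA hn 2 v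
    _ ≤ ∑ i, s * inner ℝ (hA.eigenvectorBasis hn i) v ^ 2 := by
        gcongr with i
        exact h i
    _ = (√s * ‖v‖) ^ 2 := by
        rw [← Finset.mul_sum, mul_pow, Real.sq_sqrt hs,
          ← (hA.eigenvectorBasis hn).sum_sq_norm_inner_right v]
        simp only [Real.norm_eq_abs, sq_abs]

theorem opNorm_sq_pow_le_trace {A : E →L[ℝ] E} (hA : (A : E →ₗ[ℝ] E).IsSymmetric) {p : ℕ}
    (hp : p ≠ 0) : (‖A‖ ^ 2) ^ p ≤ trace ℝ E ((A : E →ₗ[ℝ] E) ^ (2 * p)) := by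
  have htrace := trace_pow_eq_sum_eigenvalues hA rfl (2 * p)
  have hpow_nonneg : ∀ i, 0 ≤ hA.eigenvalues rfl i ^ (2 * p) :=
    fun i => (even_two_mul p).pow_nonneg _
  set M := trace ℝ E ((A : E →ₗ[ℝ] E) ^ (2 * p))
  have hM : 0 ≤ M := htrace ▸ Finset.sum_nonneg fun i _ => hpow_nonneg i
  set s := M ^ ((p : ℝ)⁻¹)
  have hs : 0 ≤ s := Real.rpow_nonneg hM _
  have hsp : s ^ p = M := Real.rpow_inv_natCast_pow hM hp
  rw [← hsp]
  gcongr
  refine opNorm_sq_le_of_eigenvalues_sq_le hA rfl hs fun i => ?_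
  rw [← pow_le_pow_iff_left₀ (sq_nonneg _) hs hp, hsp, ← pow_mul, htrace]
  exact Finset.single_le_sum (f := fun i => hA.eigenvalues rfl i ^ (2 * p))
    (fun i _ => hpow_nonneg i) (Finset.mem_univ i)

end Spectral

/-! ### The smallest eigenvalue -/

section LambdaMin

variable {n : ℕ} {A B : Vec n →L[ℝ] Vec n}

theorem lambdaMin_le_inner (hA : (A : Vec n →ₗ[ℝ] Vec n).IsSymmetric) {v : Vec n} (hv : ‖v‖ = 1) :
    lambdaMin A ≤ inner ℝ v (A v) := by
  have hn : Module.finrank ℝ (Vec n) = n := finrank_euclideanSpace_fin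
  have hle : ∀ i, lambdaMin A ≤ hA.eigenvalues hn i := fun i =>
    csInf_le (Module.End.finite_hasEigenvalue (A : Vec n →ₗ[ℝ] Vec n)).bddBelow
      (by simpa using hA.hasEigenvalue_eigenvalues hn i)
  have hweights : ∑ i, inner ℝ (hA.eigenvectorBasis hn i) v ^ 2 = 1 := by
    simpa [hv] using (hA.eigenvectorBasis hn).sum_sq_norm_inner_right v
  calc lambdaMin A = ∑ i, lambdaMin A * inner ℝ (hA.eigenvectorBasis hn i) v ^ 2 := by
        rw [← Finset.mul_sum, hweights, mul_one]
    _ ≤ ∑ i, hA.eigenvalues hn i * inner ℝ (hA.eigenvectorBasis hn i) v ^ 2 := by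
        gcongr with i
        exact hle i
    _ = inner ℝ v (A v) := by simpa using (inner_pow_apply_self hA hn 1 v).symm

theorem exists_lambdaMin_eq_inner (hn : 0 < n) (hA : (A : Vec n →ₗ[ℝ] Vec n).IsSymmetric) :
    ∃ v : Vec n, ‖v‖ = 1 ∧ lambdaMin A = inner ℝ v (A v) := by
  have hfr : Module.finrank ℝ (Vec n) = n := finrank_euclideanSpace_fin
  have hne : {μ : ℝ | Module.End.HasEigenvalue (A : Vec n →ₗ[ℝ] Vec n) μ}.Nonempty :=
    ⟨_, by simpa using hA.hasEigenvalue_eigenvalues hfr ⟨0, hn⟩⟩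
  have hmem := hne.csInf_mem (Module.End.finite_hasEigenvalue (A : Vec n →ₗ[ℝ] Vec n))
  obtain ⟨w, hw⟩ := Module.End.HasEigenvalue.exists_hasEigenvector hmem
  have hw0 : ‖w‖ ≠ 0 := norm_ne_zero_iff.2 hw.2
  have hAw : A w = lambdaMin A • w := hw.apply_eq_smul
  refine ⟨‖w‖⁻¹ • w, by rw [norm_smul, norm_inv, norm_norm, inv_mul_cancel₀ hw0], ?_⟩
  rw [map_smul, hAw]
  simp only [inner_smul_left, inner_smul_right, real_inner_self_eq_norm_sq, conj_trivial]
  field_simp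

theorem abs_inner_apply_self_le (A : Vec n →L[ℝ] Vec n) (v : Vec n) :
    |inner ℝ v (A v)| ≤ ‖A‖ * ‖v‖ ^ 2 :=
  calc |inner ℝ v (A v)| ≤ ‖v‖ * ‖A v‖ := abs_real_inner_le_norm _ _
    _ ≤ ‖v‖ * (‖A‖ * ‖v‖) := by gcongr; exact A.le_opNorm v
    _ = ‖A‖ * ‖v‖ ^ 2 := by ring

theorem abs_lambdaMin_sub_le (hn : 0 < n) (hA : (A : Vec n →ₗ[ℝ] Vec n).IsSymmetric)
    (hB : (B : Vec n →ₗ[ℝ] Vec n).IsSymmetric) : |lambdaMin A - lambdaMin B| ≤ ‖A - B‖ := by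
  have one_sided : ∀ {A B : Vec n →L[ℝ] Vec n}, (A : Vec n →ₗ[ℝ] Vec n).IsSymmetric →
      (B : Vec n →ₗ[ℝ] Vec n).IsSymmetric → lambdaMin A - lambdaMin B ≤ ‖A - B‖ := by
    intro A B hA hB
    obtain ⟨v, hv, hvB⟩ := exists_lambdaMin_eq_inner hn hB
    have hvA := lambdaMin_le_inner hA hv
    have hdiff := (le_abs_self _).trans (abs_inner_apply_self_le (A - B) v)
    rw [_root_.sub_apply, inner_sub_right, hv, one_pow, mul_one] at hdiff
    linarith
  refine abs_sub_le_iff.2 ⟨one_sided hA hB, ?_⟩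
  rw [norm_sub_rev]
  exact one_sided hB hA

end LambdaMin

/-! ### Taylor expansions under generalized smoothness -/

theorem norm_le_of_norm_deriv_le_mul_pow {V : Type*} [NormedAddCommGroup V] [NormedSpace ℝ V]
    {φ φ' : ℝ → V} {C : ℝ} {k : ℕ} (h0 : φ 0 = 0) (hφ : ∀ t, HasDerivAt φ (φ' t) t)
    (hbound : ∀ t ∈ Set.Ico (0 : ℝ) 1, ‖φ' t‖ ≤ C * t ^ k) {t : ℝ} (ht : t ∈ Set.Icc (0 : ℝ) 1) :
    ‖φ t‖ ≤ C / (k + 1) * t ^ (k + 1) := by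
  refine image_norm_le_of_norm_deriv_right_le_deriv_boundary (a := 0) (b := 1)
    (B := fun t => C / (k + 1) * t ^ (k + 1)) (B' := fun t => C * t ^ k)
    (fun t _ => (hφ t).continuousAt.continuousWithinAt) (fun t _ => (hφ t).hasDerivWithinAt)
    (by simp [h0]) (fun t => ?_) hbound ht
  refine ((hasDerivAt_pow (k + 1) t).const_mul (C / (k + 1))).congr_deriv ?_
  rw [Nat.add_sub_cancel]
  push_cast
  field_simp

section Taylor

variable {n : ℕ} {F : Vec n → ℝ}

theorem hasDerivAt_add_smul {V : Type*} [NormedAddCommGroup V] [NormedSpace ℝ V] (x d : V)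
    (t : ℝ) : HasDerivAt (fun t : ℝ => x + t • d) d t := by
  simpa using ((hasDerivAt_id t).smul_const d).const_add x

theorem hasDerivAt_comp_add_smul (hF : Differentiable ℝ F) (x d : Vec n) (t : ℝ) :
    HasDerivAt (fun t : ℝ => F (x + t • d)) (inner ℝ (gradient F (x + t • d)) d) t := by
  rw [inner_gradient_left]
  exact (hF _).hasFDerivAt.comp_hasDerivAt t (hasDerivAt_add_smul x d t)

theorem TwiceDifferentiable.hasDerivAt_gradient_add_smul (hF : TwiceDifferentiable F)
    (x d : Vec n) (t : ℝ) :
    HasDerivAt (fun t : ℝ => gradient F (x + t • d)) (hessian F (x + t • d) d) t :=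
  (hF.2 _).hasFDerivAt.comp_hasDerivAt t (hasDerivAt_add_smul x d t)

theorem TwiceDifferentiable.hessian_isSymmetric (hF : TwiceDifferentiable F) (x : Vec n) :
    (hessian F x : Vec n →ₗ[ℝ] Vec n).IsSymmetric := by
  intro v w
  let J : Vec n →L[ℝ] StrongDual ℝ (Vec n) := innerSL ℝ
  have hF' : ∀ y, HasFDerivAt F (J (gradient F y)) y :=
    fun y => (hF.1 y).hasGradientAt.hasFDerivAt
  have hF'' : HasFDerivAt (fun y => J (gradient F y)) (J.comp (hessian F x)) x :=
    J.hasFDerivAt.comp x (hF.2 x).hasFDerivAt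
  have hsymm : inner ℝ (hessian F x v) w = inner ℝ (hessian F x w) v :=
    second_derivative_symmetric hF' hF'' v w
  rw [ContinuousLinearMap.coe_coe, hsymm, real_inner_comm]

namespace GeneralizedSmooth

variable {L₀ L₁ : ℝ} {x d : Vec n}

theorem norm_gradient_sub_le (hF : GeneralizedSmooth F L₀ L₁) (hd : L₁ * ‖d‖ ≤ 1) :
    ‖gradient F (x + d) - gradient F x‖ ≤ (L₀ + L₁ * ‖gradient F x‖) * ‖d‖ := by
  have h := hF.2 x (x + d)
  rw [sub_add_cancel_left, norm_neg] at h
  rw [norm_sub_rev]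
  exact h hd

theorem norm_gradient_add_le (hF : GeneralizedSmooth F L₀ L₁) (hd : L₁ * ‖d‖ ≤ 1) :
    ‖gradient F (x + d)‖ ≤ ‖gradient F x‖ + (L₀ + L₁ * ‖gradient F x‖) * ‖d‖ :=
  norm_le_norm_add_norm_sub' _ _ |>.trans (by gcongr; exact hF.norm_gradient_sub_le hd)

theorem abs_taylor_le (hF : GeneralizedSmooth F L₀ L₁) (hd : L₁ * ‖d‖ ≤ 1) :
    |F (x + d) - F x - inner ℝ (gradient F x) d| ≤
      (L₀ + L₁ * ‖gradient F x‖) / 2 * ‖d‖ ^ 2 := by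
  have hderiv : ∀ t : ℝ, HasDerivAt
      (fun t : ℝ => F (x + t • d) - F x - t * inner ℝ (gradient F x) d)
      (inner ℝ (gradient F (x + t • d) - gradient F x) d) t := by
    intro t
    refine (((hasDerivAt_comp_add_smul hF.1 x d t).sub_const (F x)).sub
      ((hasDerivAt_id t).mul_const (inner ℝ (gradient F x) d))).congr_deriv ?_
    rw [one_mul, inner_sub_left]
  have h := norm_le_of_norm_deriv_le_mul_pow (k := 1)
    (C := (L₀ + L₁ * ‖gradient F x‖) * ‖d‖ ^ 2) (by simp) hderiv (fun t ht => ?_)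
    (Set.right_mem_Icc.2 zero_le_one)
  · simp only [one_smul, one_mul, one_pow, mul_one, Nat.cast_one, Real.norm_eq_abs] at h
    linarith
  · have htd : ‖t • d‖ = t * ‖d‖ := by rw [norm_smul, Real.norm_of_nonneg ht.1]
    have hrange : L₁ * ‖t • d‖ ≤ 1 := by
      rw [htd]
      nlinarith [ht.1, ht.2]
    calc ‖inner ℝ (gradient F (x + t • d) - gradient F x) d‖
        ≤ (L₀ + L₁ * ‖gradient F x‖) * ‖t • d‖ * ‖d‖ :=
          (norm_inner_le_norm _ _).trans (by gcongr; exact hF.norm_gradient_sub_le hrange)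
      _ = (L₀ + L₁ * ‖gradient F x‖) * ‖d‖ ^ 2 * t ^ 1 := by rw [htd]; ring

theorem norm_gradient_le_initialGap (hF : GeneralizedSmooth F L₀ L₁) (hL₀ : 0 ≤ L₀)
    (hbdd : BddBelow (Set.range F)) (x : Vec n) {r : ℝ} (hr : 0 < r) (hL₁r : L₁ * r ≤ 1) :
    ‖gradient F x‖ ≤ 2 * initialGap F x / r + L₀ * r := by
  have hgap : ∀ y, F x - F y ≤ initialGap F x := fun y => sub_le_sub_left (ciInf_le hbdd y) _
  rcases eq_or_ne (gradient F x) 0 with hg | hg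
  · have : 0 ≤ initialGap F x := by simpa using hgap x
    rw [hg, norm_zero]
    positivity
  have hg' : ‖gradient F x‖ ≠ 0 := norm_ne_zero_iff.2 hg
  set d := -(r / ‖gradient F x‖) • gradient F x with hd
  have hdr : ‖d‖ = r := by
    rw [hd, norm_smul, norm_neg, Real.norm_of_nonneg (by positivity), div_mul_cancel₀ _ hg']
  have hgd : inner ℝ (gradient F x) d = -(r * ‖gradient F x‖) := by
    rw [hd, real_inner_smul_right, real_inner_self_eq_norm_sq]
    field_simp
  have htaylor := (le_abs_self _).trans (hF.abs_taylor_le (x := x) (d := d) (by rwa [hdr]))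
  rw [hgd, hdr] at htaylor
  have hL₁ : L₁ * r * (r * ‖gradient F x‖) ≤ 1 * (r * ‖gradient F x‖) := by gcongr
  rw [div_add' _ _ _ hr.ne', le_div_iff₀ hr]
  linarith [hgap (x + d)]

end GeneralizedSmooth

namespace SecondOrderGeneralizedSmooth

variable {δ r M₀ M₁ L₀ L₁ : ℝ} {x d : Vec n}

theorem norm_hessian_sub_le (hF : SecondOrderGeneralizedSmooth F r M₀ M₁) (hd : ‖d‖ ≤ r) :
    ‖hessian F (x + d) - hessian F x‖ ≤ (M₀ + M₁ * ‖gradient F x‖) * ‖d‖ := by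
  have h := hF.2 x (x + d)
  rw [sub_add_cancel_left, norm_neg] at h
  rw [norm_sub_rev]
  exact h hd

theorem norm_gradient_taylor_le (hF : SecondOrderGeneralizedSmooth F r M₀ M₁) (hd : ‖d‖ ≤ r) :
    ‖gradient F (x + d) - gradient F x - hessian F x d‖ ≤
      (M₀ + M₁ * ‖gradient F x‖) / 2 * ‖d‖ ^ 2 := by
  have hderiv : ∀ t : ℝ, HasDerivAt
      (fun t : ℝ => gradient F (x + t • d) - gradient F x - t • hessian F x d)
      ((hessian F (x + t • d) - hessian F x) d) t := by
    intro t
    refine (((hF.1.hasDerivAt_gradient_add_smul x d t).sub_const (gradient F x)).sub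
      ((hasDerivAt_id t).smul_const (hessian F x d))).congr_deriv ?_
    rw [one_smul, _root_.sub_apply]
  have h := norm_le_of_norm_deriv_le_mul_pow (k := 1)
    (C := (M₀ + M₁ * ‖gradient F x‖) * ‖d‖ ^ 2) (by simp) hderiv (fun t ht => ?_)
    (Set.right_mem_Icc.2 zero_le_one)
  · simp only [one_smul, one_pow, mul_one, Nat.cast_one] at h
    linarith
  · have htd : ‖t • d‖ = t * ‖d‖ := by rw [norm_smul, Real.norm_of_nonneg ht.1]
    have hrange : ‖t • d‖ ≤ r := by
      rw [htd]
      exact (mul_le_of_le_one_left (norm_nonneg d) ht.2.le).trans hd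
    calc ‖(hessian F (x + t • d) - hessian F x) d‖
        ≤ (M₀ + M₁ * ‖gradient F x‖) * ‖t • d‖ * ‖d‖ :=
          (ContinuousLinearMap.le_opNorm _ _).trans (by gcongr; exact hF.norm_hessian_sub_le hrange)
      _ = (M₀ + M₁ * ‖gradient F x‖) * ‖d‖ ^ 2 * t ^ 1 := by rw [htd]; ring

theorem abs_taylor_le (hF : SecondOrderGeneralizedSmooth F r M₀ M₁) (hd : ‖d‖ ≤ r) :
    |F (x + d) - F x - inner ℝ (gradient F x) d - 1 / 2 * inner ℝ d (hessian F x d)| ≤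
      (M₀ + M₁ * ‖gradient F x‖) / 6 * ‖d‖ ^ 3 := by
  have hderiv : ∀ t : ℝ, HasDerivAt
      (fun t : ℝ => F (x + t • d) - F x - t * inner ℝ (gradient F x) d -
        t ^ 2 * (1 / 2 * inner ℝ d (hessian F x d)))
      (inner ℝ (gradient F (x + t • d) - gradient F x - hessian F x (t • d)) d) t := by
    intro t
    refine ((((hasDerivAt_comp_add_smul hF.1.1 x d t).sub_const (F x)).sub
      ((hasDerivAt_id t).mul_const (inner ℝ (gradient F x) d))).sub
      ((hasDerivAt_pow 2 t).mul_const (1 / 2 * inner ℝ d (hessian F x d)))).congr_deriv ?_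
    rw [inner_sub_left, inner_sub_left, map_smul, real_inner_smul_left,
      real_inner_comm d (hessian F x d)]
    ring
  have h := norm_le_of_norm_deriv_le_mul_pow (k := 2)
    (C := (M₀ + M₁ * ‖gradient F x‖) / 2 * ‖d‖ ^ 3) (by simp) hderiv (fun t ht => ?_)
    (Set.right_mem_Icc.2 zero_le_one)
  · norm_num only [one_smul, one_mul, one_pow, mul_one, Real.norm_eq_abs] at h
    linarith
  · have htd : ‖t • d‖ = t * ‖d‖ := by rw [norm_smul, Real.norm_of_nonneg ht.1]
    have hrange : ‖t • d‖ ≤ r := by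
      rw [htd]
      exact (mul_le_of_le_one_left (norm_nonneg d) ht.2.le).trans hd
    calc ‖inner ℝ (gradient F (x + t • d) - gradient F x - hessian F x (t • d)) d‖
        ≤ (M₀ + M₁ * ‖gradient F x‖) / 2 * ‖t • d‖ ^ 2 * ‖d‖ :=
          (norm_inner_le_norm _ _).trans (by gcongr; exact hF.norm_gradient_taylor_le hrange)
      _ = (M₀ + M₁ * ‖gradient F x‖) / 2 * ‖d‖ ^ 3 * t ^ 2 := by rw [htd]; ring

theorem continuous_hessian (hr : 0 < r) (hF : SecondOrderGeneralizedSmooth F r M₀ M₁) :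
    Continuous (hessian F) := by
  rw [continuous_iff_continuousAt]
  intro x
  have hlim : Filter.Tendsto (fun y => (M₀ + M₁ * ‖gradient F x‖) * ‖x - y‖) (nhds x) (nhds 0) := by
    have : Continuous fun y => (M₀ + M₁ * ‖gradient F x‖) * ‖x - y‖ := by fun_prop
    simpa using this.tendsto x
  refine tendsto_iff_norm_sub_tendsto_zero.2
    (squeeze_zero' (Filter.Eventually.of_forall fun _ => norm_nonneg _) ?_ hlim)
  filter_upwards [Metric.closedBall_mem_nhds x hr] with y hy
  rw [norm_sub_rev]
  exact hF.2 x y (by rwa [← dist_eq_norm, dist_comm])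

theorem continuous_lambdaMin_hessian (hn : 0 < n) (hr : 0 < r)
    (hF : SecondOrderGeneralizedSmooth F r M₀ M₁) :
    Continuous fun x => lambdaMin (hessian F x) := by
  rw [continuous_iff_continuousAt]
  intro x
  refine tendsto_iff_norm_sub_tendsto_zero.2 (squeeze_zero (fun _ => norm_nonneg _) (fun y => ?_)
    (tendsto_iff_norm_sub_tendsto_zero.1 ((hF.continuous_hessian hr).tendsto x)))
  exact abs_lambdaMin_sub_le hn (hF.1.hessian_isSymmetric y) (hF.1.hessian_isSymmetric x)

theorem norm_hessian_chain_step_le (hF : SecondOrderGeneralizedSmooth F δ M₀ M₁)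
    (hG : GeneralizedSmooth F L₀ L₁) (hM₁ : 0 ≤ M₁) (hd : L₁ * ‖d‖ ≤ 1) {N k : ℕ} (hk : k < N)
    (hN : ‖d‖ / N ≤ δ) :
    ‖hessian F (x + ((k : ℝ) / N) • d) - hessian F (x + (((k + 1 : ℕ) : ℝ) / N) • d)‖ ≤
      (M₀ + M₁ * ‖gradient F x‖) * (‖d‖ / N) +
        M₁ * (L₀ + L₁ * ‖gradient F x‖) * (‖d‖ / N) ^ 2 * k := by
  have hN0 : (0 : ℝ) < N := by exact_mod_cast k.zero_le.trans_lt hk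
  have hkN : (k : ℝ) / N ≤ 1 := (div_le_one hN0).2 (by exact_mod_cast hk.le)
  have hstep : ‖x + ((k : ℝ) / N) • d - (x + (((k + 1 : ℕ) : ℝ) / N) • d)‖ = ‖d‖ / N := by
    rw [add_sub_add_left_eq_sub, ← sub_smul, norm_smul, ← sub_div, Nat.cast_add_one,
      sub_add_cancel_left, norm_div, norm_neg, norm_one, RCLike.norm_natCast]
    ring
  have hkd : ‖((k : ℝ) / N) • d‖ = k / N * ‖d‖ := by
    rw [norm_smul, Real.norm_of_nonneg (by positivity)]
  have hgrad := hG.norm_gradient_add_le (x := x) (d := ((k : ℝ) / N) • d) (by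
    rw [hkd]
    nlinarith [show (0 : ℝ) ≤ k / N by positivity])
  rw [hkd] at hgrad
  calc _ ≤ (M₀ + M₁ * ‖gradient F (x + ((k : ℝ) / N) • d)‖) * (‖d‖ / N) := by
        rw [← hstep]
        exact hF.2 _ _ (hstep.trans_le hN)
    _ ≤ (M₀ + M₁ * (‖gradient F x‖ + (L₀ + L₁ * ‖gradient F x‖) * (k / N * ‖d‖))) * (‖d‖ / N) := by
        gcongr
    _ = _ := by ring

/-- The Hessian increments are chained along a subdivision of the segment into pieces of length at
most `δ`, between which the gradient grows at most linearly. -/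
theorem extend_radius (hF : SecondOrderGeneralizedSmooth F δ M₀ M₁)
    (hG : GeneralizedSmooth F L₀ L₁) (hδ : 0 < δ) (hL₀ : 0 ≤ L₀) (hL₁ : 0 ≤ L₁) (hM₁ : 0 ≤ M₁)
    (hr : L₁ * r ≤ 1) :
    SecondOrderGeneralizedSmooth F r (M₀ + M₁ * L₀ * r / 2) (3 / 2 * M₁) := by
  refine ⟨hF.1, fun x x' hxx' => ?_⟩
  obtain ⟨d, rfl⟩ : ∃ d, x' = x + d := ⟨x' - x, (add_sub_cancel x x').symm⟩
  rw [sub_add_cancel_left, norm_neg] at hxx' ⊢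
  set u := ‖gradient F x‖
  have hd : L₁ * ‖d‖ ≤ 1 := (by gcongr : L₁ * ‖d‖ ≤ L₁ * r).trans hr
  obtain ⟨N, hN⟩ := exists_nat_gt (‖d‖ / δ)
  have hN0 : 0 < (N : ℝ) := lt_of_le_of_lt (by positivity) hN
  have hchain := dist_le_range_sum_of_dist_le
    (f := fun k : ℕ => hessian F (x + ((k : ℝ) / N) • d))
    (d := fun k => (M₀ + M₁ * u) * (‖d‖ / N) + M₁ * (L₀ + L₁ * u) * (‖d‖ / N) ^ 2 * k) N
    fun {k} hk => by
      rw [dist_eq_norm]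
      exact hF.norm_hessian_chain_step_le hG hM₁ hd hk ((div_lt_comm₀ hδ hN0).1 hN).le
  simp only [Nat.cast_zero, zero_div, zero_smul, add_zero, div_self hN0.ne', one_smul,
    dist_eq_norm, Finset.sum_add_distrib, ← Finset.mul_sum, Finset.sum_const, Finset.card_range,
    nsmul_eq_mul] at hchain
  have hgauss : ∑ k ∈ Finset.range N, (k : ℝ) ≤ N ^ 2 / 2 := by
    have h := (Finset.sum_range_id_mul_two N).trans_le (Nat.mul_le_mul_left N (Nat.sub_le N 1))
    have : (∑ k ∈ Finset.range N, (k : ℝ)) * 2 ≤ N * N := by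
      rw [← Nat.cast_sum]
      exact_mod_cast h
    linarith
  calc ‖hessian F x - hessian F (x + d)‖
      ≤ (M₀ + M₁ * u) * (N * (‖d‖ / N)) +
          M₁ * (L₀ + L₁ * u) * (‖d‖ / N) ^ 2 * (N ^ 2 / 2) := hchain.trans (by gcongr)
    _ = (M₀ + M₁ * u) * ‖d‖ + M₁ * (L₀ * ‖d‖ + L₁ * ‖d‖ * u) / 2 * ‖d‖ := by field_simp
    _ ≤ (M₀ + M₁ * u) * ‖d‖ + M₁ * (L₀ * r + 1 * u) / 2 * ‖d‖ := by gcongr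
    _ = (M₀ + M₁ * L₀ * r / 2 + 3 / 2 * M₁ * u) * ‖d‖ := by ring

end SecondOrderGeneralizedSmooth

end Taylor

/-! ### The trust region subproblem -/

section TrustRegion

variable {n : ℕ} {c r : ℝ} {g d : Vec n} {B : Vec n →L[ℝ] Vec n}

theorem hasGradientAt_trModel (c : ℝ) (g : Vec n)
    (hB : (B : Vec n →ₗ[ℝ] Vec n).IsSymmetric) (d : Vec n) :
    HasGradientAt (trModel c g B) (g + B d) d := by
  have hquad := (hasFDerivAt_id d).inner ℝ B.hasFDerivAt
  have h := (((innerSL ℝ g).hasFDerivAt.const_add c).add (hquad.const_mul (1 / 2)))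
  refine h.congr_fderiv (ContinuousLinearMap.ext fun e => ?_)
  have hsymm : inner ℝ d (B e) = inner ℝ e (B d) := by
    rw [real_inner_comm]
    exact hB e d
  simp [hsymm, real_inner_comm e]
  ring

namespace IsTRSolution

theorem inner_nonneg (h : IsTRSolution c g B r d) (hB : (B : Vec n →ₗ[ℝ] Vec n).IsSymmetric)
    {d' : Vec n} (hd' : ‖d'‖ ≤ r) : 0 ≤ inner ℝ (g + B d) (d' - d) := by
  have hmin : IsMinOn (trModel c g B) (Metric.closedBall 0 r) d :=
    fun e he => h.2 e (mem_closedBall_zero_iff.1 he)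
  refine hmin.localize.hasFDerivWithinAt_nonneg
    (hasGradientAt_trModel c g hB d).hasFDerivAt.hasFDerivWithinAt
    (sub_mem_posTangentConeAt_of_segment_subset ?_)
  exact (convex_closedBall 0 r).segment_subset (mem_closedBall_zero_iff.2 h.1)
    (mem_closedBall_zero_iff.2 hd')

theorem inner_residual_le (h : IsTRSolution c g B r d) (hr : 0 ≤ r)
    (hB : (B : Vec n →ₗ[ℝ] Vec n).IsSymmetric) :
    inner ℝ (g + B d) d ≤ -(r * ‖g + B d‖) := by
  rcases eq_or_ne (g + B d) 0 with hzero | hne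
  · simp [hzero]
  have hnorm : ‖g + B d‖ ≠ 0 := norm_ne_zero_iff.2 hne
  have hball : ‖-(r / ‖g + B d‖) • (g + B d)‖ ≤ r := by
    rw [norm_smul, norm_neg, Real.norm_of_nonneg (by positivity), div_mul_cancel₀ _ hnorm]
  have hopt := h.inner_nonneg hB hball
  have hscale : -(r / ‖g + B d‖) * ‖g + B d‖ ^ 2 = -(r * ‖g + B d‖) := by field_simp
  rw [inner_sub_right, real_inner_smul_right, real_inner_self_eq_norm_sq, hscale] at hopt
  linarith

theorem trModel_le_sub_norm_residual (h : IsTRSolution c g B r d) (hr : 0 ≤ r)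
    (hB : (B : Vec n →ₗ[ℝ] Vec n).IsSymmetric) :
    trModel c g B d ≤ c - 1 / 2 * r * ‖g + B d‖ := by
  have hgd : inner ℝ g d ≤ 0 := by
    have hneg : trModel c g B d ≤ trModel c g B (-d) := h.2 _ (by simpa using h.1)
    simp only [trModel, inner_neg_right, map_neg, inner_neg_left] at hneg
    linarith
  have hres := h.inner_residual_le hr hB
  rw [inner_add_left, real_inner_comm d (B d)] at hres
  rw [trModel]
  linarith

theorem trModel_le_add_curvature (h : IsTRSolution c g B r d) (hr : 0 ≤ r) {v : Vec n}
    (hv : ‖v‖ = 1) : trModel c g B d ≤ c + 1 / 2 * r ^ 2 * inner ℝ v (B v) := by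
  have hnorm : ‖r • v‖ ≤ r := by rw [norm_smul, hv, Real.norm_of_nonneg hr, mul_one]
  have hpos := h.2 (r • v) hnorm
  have hneg := h.2 (-(r • v)) (by rwa [norm_neg])
  simp only [trModel, inner_neg_right, map_neg, inner_neg_left, map_smul, real_inner_smul_left,
    real_inner_smul_right] at hpos hneg ⊢
  linarith

end IsTRSolution

end TrustRegion

/-! ### Descent in one step -/

section Descent

variable {n : ℕ} {F : Vec n → ℝ} {M₀ M₁ r : ℝ} {x g d : Vec n} {B : Vec n →L[ℝ] Vec n}

theorem objective_le_trModel (hF : SecondOrderGeneralizedSmooth F r M₀ M₁) (hM₀ : 0 ≤ M₀)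
    (hM₁ : 0 ≤ M₁) (g : Vec n) (B : Vec n →L[ℝ] Vec n) (hd : ‖d‖ ≤ r) :
    F (x + d) ≤ trModel (F x) g B d + r * ‖g - gradient F x‖ + r ^ 2 / 2 * ‖B - hessian F x‖ +
      (M₀ + M₁ * ‖gradient F x‖) / 6 * r ^ 3 := by
  have hr : 0 ≤ r := (norm_nonneg d).trans hd
  have hgrad : -(inner ℝ (g - gradient F x) d) ≤ r * ‖g - gradient F x‖ :=
    calc -(inner ℝ (g - gradient F x) d) ≤ ‖g - gradient F x‖ * ‖d‖ :=
          (neg_le_abs _).trans (abs_real_inner_le_norm _ _)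
      _ ≤ r * ‖g - gradient F x‖ := by rw [mul_comm]; gcongr
  have hhess : -(inner ℝ d ((B - hessian F x) d)) ≤ r ^ 2 * ‖B - hessian F x‖ :=
    calc -(inner ℝ d ((B - hessian F x) d)) ≤ ‖B - hessian F x‖ * ‖d‖ ^ 2 :=
          (neg_le_abs _).trans (abs_inner_apply_self_le _ _)
      _ ≤ r ^ 2 * ‖B - hessian F x‖ := by rw [mul_comm]; gcongr
  have htaylor := (abs_le.1 (hF.abs_taylor_le (x := x) hd)).2
  have hcube : (M₀ + M₁ * ‖gradient F x‖) / 6 * ‖d‖ ^ 3 ≤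
      (M₀ + M₁ * ‖gradient F x‖) / 6 * r ^ 3 := by gcongr
  rw [inner_sub_left] at hgrad
  rw [_root_.sub_apply, inner_sub_right] at hhess
  rw [trModel]
  linarith

theorem norm_gradient_add_le_norm_residual_add (hF : SecondOrderGeneralizedSmooth F r M₀ M₁)
    (hM₀ : 0 ≤ M₀) (hM₁ : 0 ≤ M₁) (g : Vec n) (B : Vec n →L[ℝ] Vec n) (hd : ‖d‖ ≤ r) :
    ‖gradient F (x + d)‖ ≤ ‖g + B d‖ + ‖g - gradient F x‖ + r * ‖B - hessian F x‖ +
      (M₀ + M₁ * ‖gradient F x‖) / 2 * r ^ 2 :=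
  calc ‖gradient F (x + d)‖
      = ‖(g + B d) - (g - gradient F x) - (B - hessian F x) d +
          (gradient F (x + d) - gradient F x - hessian F x d)‖ := by
        rw [_root_.sub_apply]
        congr 1
        abel
    _ ≤ ‖g + B d‖ + ‖g - gradient F x‖ + ‖(B - hessian F x) d‖ +
          ‖gradient F (x + d) - gradient F x - hessian F x d‖ :=
        (norm_add_le _ _).trans (add_le_add_left ((norm_sub_le _ _).trans
          (add_le_add_left (norm_sub_le _ _) _)) _)
    _ ≤ ‖g + B d‖ + ‖g - gradient F x‖ + r * ‖B - hessian F x‖ +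
          (M₀ + M₁ * ‖gradient F x‖) / 2 * r ^ 2 := by
        gcongr
        · rw [mul_comm]
          exact (B - hessian F x).le_opNorm_of_le hd
        · exact (hF.norm_gradient_taylor_le hd).trans (by gcongr)

namespace IsTRSolution

theorem descent_gradient (h : IsTRSolution (F x) g B r d)
    (hF : SecondOrderGeneralizedSmooth F r M₀ M₁) (hM₀ : 0 ≤ M₀) (hM₁ : 0 ≤ M₁)
    (hB : (B : Vec n →ₗ[ℝ] Vec n).IsSymmetric) :
    F (x + d) - F x + 1 / 2 * r * ‖gradient F (x + d)‖ ≤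
      3 / 2 * r * ‖g - gradient F x‖ + r ^ 2 * ‖B - hessian F x‖ +
        5 / 12 * (M₀ + M₁ * ‖gradient F x‖) * r ^ 3 := by
  have hr : 0 ≤ r := (norm_nonneg d).trans h.1
  have hobjective := objective_le_trModel (x := x) hF hM₀ hM₁ g B h.1
  have hmodel := h.trModel_le_sub_norm_residual hr hB
  have hgradient := mul_le_mul_of_nonneg_left
    (norm_gradient_add_le_norm_residual_add (x := x) hF hM₀ hM₁ g B h.1) hr
  linarith

theorem descent_curvature (h : IsTRSolution (F x) g B r d) (hn : 0 < n)
    (hF : SecondOrderGeneralizedSmooth F r M₀ M₁) (hM₀ : 0 ≤ M₀) (hM₁ : 0 ≤ M₁) :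
    F (x + d) - F x - 1 / 2 * r ^ 2 * lambdaMin (hessian F (x + d)) ≤
      3 / 2 * r * ‖g - gradient F x‖ + r ^ 2 * ‖B - hessian F x‖ +
        2 / 3 * (M₀ + M₁ * ‖gradient F x‖) * r ^ 3 := by
  have hr : 0 ≤ r := (norm_nonneg d).trans h.1
  have hobjective := objective_le_trModel (x := x) hF hM₀ hM₁ g B h.1
  obtain ⟨v, hv, heigen⟩ := exists_lambdaMin_eq_inner hn (hF.1.hessian_isSymmetric (x + d))
  have hmodel := h.trModel_le_add_curvature hr hv
  have hestimate : inner ℝ v ((B - hessian F x) v) ≤ ‖B - hessian F x‖ := by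
    simpa only [hv, one_pow, mul_one] using
      (le_abs_self _).trans (abs_inner_apply_self_le (B - hessian F x) v)
  have hdrift : -(inner ℝ v ((hessian F (x + d) - hessian F x) v)) ≤
      (M₀ + M₁ * ‖gradient F x‖) * r := by
    refine (neg_le_abs _).trans ((abs_inner_apply_self_le _ v).trans ?_)
    rw [hv, one_pow, mul_one]
    exact (hF.norm_hessian_sub_le h.1).trans (by gcongr; exact h.1)
  rw [_root_.sub_apply, inner_sub_right] at hestimate hdrift
  have hcurvature : inner ℝ v (B v) ≤ lambdaMin (hessian F (x + d)) + ‖B - hessian F x‖ +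
      (M₀ + M₁ * ‖gradient F x‖) * r := by
    rw [heigen]
    linarith
  have hscaled := mul_le_mul_of_nonneg_left hcurvature (sq_nonneg r)
  have hnonneg : 0 ≤ r * ‖g - gradient F x‖ := by positivity
  linarith

end IsTRSolution

end Descent

/-! ### A Khintchine inequality for symmetric operators -/

section Khintchine

open LinearMap (trace)
open scoped BigOperators

/-- The sum `∑ᵢ σᵢ Hᵢ` of a family with random signs, the signs being the units of `ℤ`. -/
def signedSum {ι V : Type*} [Fintype ι] [AddCommGroup V] (H : ι → V) (σ : ι → ℤˣ) : V :=
  ∑ i, σ i • H i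

theorem expect_le_expect_of_add_comp_le {α : Type*} [Fintype α] (e : Equiv.Perm α) {f g : α → ℝ}
    (h : ∀ a, f a + f (e a) ≤ g a + g (e a)) : 𝔼 a, f a ≤ 𝔼 a, g a := by
  have hmean : 𝔼 a, (f a + f (e a)) ≤ 𝔼 a, (g a + g (e a)) := Finset.expect_le_expect fun a _ => h a
  have hcomp : ∀ u : α → ℝ, 𝔼 a, u (e a) = 𝔼 a, u a :=
    fun u => Fintype.expect_equiv e _ _ fun _ => rfl
  rw [Finset.expect_add_distrib, Finset.expect_add_distrib, hcomp f, hcomp g] at hmean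
  linarith

theorem two_mul_add_one_mul_pow_le (p : ℕ) : (2 * (p : ℝ) + 1) * p ^ p ≤ (p + 1 : ℝ) ^ (p + 1) := by
  rcases Nat.eq_zero_or_pos p with rfl | hp
  · simp
  have hp' : (0 : ℝ) < p := by exact_mod_cast hp
  have hbernoulli : 2 * (p : ℝ) ^ p ≤ (p + 1 : ℝ) ^ p :=
    calc 2 * (p : ℝ) ^ p = (1 + p * (1 / (p : ℝ))) * p ^ p := by field_simp; ring
      _ ≤ (1 + 1 / (p : ℝ)) ^ p * p ^ p := by
        gcongr
        exact one_add_mul_le_pow (by linarith [one_div_pos.2 hp']) p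
      _ = (p + 1 : ℝ) ^ p := by rw [← mul_pow]; congr 1; field_simp
  calc (2 * (p : ℝ) + 1) * p ^ p ≤ (p + 1) * (2 * (p : ℝ) ^ p) := by
        linarith [pow_nonneg hp'.le p]
    _ ≤ (p + 1 : ℝ) ^ (p + 1) := by
        rw [pow_succ']
        gcongr

variable {E : Type*} [NormedAddCommGroup E] [InnerProductSpace ℝ E] {ι : Type*} [Fintype ι]

theorem isSymmetric_units_smul {A : E →ₗ[ℝ] E} (hA : A.IsSymmetric) (u : ℤˣ) :
    (u • A).IsSymmetric := by
  rcases Int.units_eq_one_or u with rfl | rfl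
  · rwa [one_smul]
  · rw [Units.neg_smul, one_smul]
    exact fun x y => by
      rw [LinearMap.neg_apply, LinearMap.neg_apply, inner_neg_left, inner_neg_right, hA x y]

theorem signedSum_isSymmetric {H : ι → E →ₗ[ℝ] E} (hH : ∀ i, (H i).IsSymmetric) (σ : ι → ℤˣ) :
    (signedSum H σ).IsSymmetric :=
  Finset.sum_induction _ LinearMap.IsSymmetric (fun _ _ => LinearMap.IsSymmetric.add) .zero
    fun i _ => isSymmetric_units_smul (hH i) (σ i)

variable [DecidableEq ι]

theorem signedSum_sub_signedSum_flip {V : Type*} [AddCommGroup V] (H : ι → V)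
    (i : ι) (σ : ι → ℤˣ) :
    signedSum H σ - signedSum H (Pi.mulSingle i (-1) * σ) = σ i • H i + σ i • H i := by
  rw [signedSum, signedSum, ← Finset.sum_sub_distrib, Finset.sum_eq_single i]
  · simp [Units.neg_smul]
  · intro j _ hj
    simp [Pi.mulSingle_eq_of_ne hj]
  · simp

variable [FiniteDimensional ℝ E] {H : ι → E →ₗ[ℝ] E} {c : ι → ℝ}

theorem expect_trace_signedSum_pow_succ_mul_le (hH : ∀ i, (H i).IsSymmetric)
    (hc : ∀ i v, ‖H i v‖ ≤ c i * ‖v‖) {N : ℕ} (hN : Even N) (i : ι) :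
    𝔼 σ, trace ℝ E (signedSum H σ ^ (N + 1) * (σ i • H i)) ≤
      (N + 1) * c i ^ 2 * 𝔼 σ, trace ℝ E (signedSum H σ ^ N) := by
  rw [Finset.mul_expect]
  refine expect_le_expect_of_add_comp_le (Equiv.mulLeft (Pi.mulSingle i (-1))) fun σ => ?_
  set K := σ i • H i with hK
  set A := signedSum H σ
  set B := signedSum H (Equiv.mulLeft (Pi.mulSingle i (-1)) σ)
  have hflip : Equiv.mulLeft (Pi.mulSingle i (-1)) σ i • H i = -K := by simp [hK, Units.neg_smul]
  have hA : A.IsSymmetric := signedSum_isSymmetric hH _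
  have hB : B.IsSymmetric := signedSum_isSymmetric hH _
  have hK_symm : K.IsSymmetric := isSymmetric_units_smul (hH i) _
  have hAB : A - B = (2 : ℝ) • K := by
    rw [two_smul]
    exact signedSum_sub_signedSum_flip H i σ
  have hK_norm : ∀ v, ‖K v‖ ≤ c i * ‖v‖ := by
    intro v
    have happly : K v = σ i • H i v := rfl
    rw [happly, norm_units_zsmul]
    exact hc i v
  rw [hflip, mul_neg, map_neg, ← sub_eq_add_neg]
  calc trace ℝ E (A ^ (N + 1) * K) - trace ℝ E (B ^ (N + 1) * K)
      ≤ (N + 1) * (trace ℝ E (A ^ N * K * K) + trace ℝ E (B ^ N * K * K)) :=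
        trace_pow_succ_mul_sub_le hA hB hK_symm hAB hN
    _ ≤ (N + 1) * (c i ^ 2 * trace ℝ E (A ^ N) + c i ^ 2 * trace ℝ E (B ^ N)) := by
        gcongr
        · exact trace_pow_mul_mul_self_le hA hK_symm hN hK_norm
        · exact trace_pow_mul_mul_self_le hB hK_symm hN hK_norm
    _ = (N + 1) * c i ^ 2 * trace ℝ E (A ^ N) + (N + 1) * c i ^ 2 * trace ℝ E (B ^ N) := by ring

theorem expect_trace_signedSum_pow_add_two_le (hH : ∀ i, (H i).IsSymmetric)
    (hc : ∀ i v, ‖H i v‖ ≤ c i * ‖v‖) {N : ℕ} (hN : Even N) :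
    𝔼 σ, trace ℝ E (signedSum H σ ^ (N + 2)) ≤
      (N + 1) * (∑ i, c i ^ 2) * 𝔼 σ, trace ℝ E (signedSum H σ ^ N) := by
  have hsplit : ∀ σ, trace ℝ E (signedSum H σ ^ (N + 2)) =
      ∑ i, trace ℝ E (signedSum H σ ^ (N + 1) * (σ i • H i)) := by
    intro σ
    rw [← map_sum, ← Finset.mul_sum, ← signedSum, ← pow_succ]
  simp only [hsplit]
  rw [Finset.expect_sum_comm, Finset.mul_sum, Finset.sum_mul]
  exact Finset.sum_le_sum fun i _ => expect_trace_signedSum_pow_succ_mul_le hH hc hN i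

theorem expect_trace_signedSum_pow_le (hH : ∀ i, (H i).IsSymmetric)
    (hc : ∀ i v, ‖H i v‖ ≤ c i * ‖v‖) (p : ℕ) :
    𝔼 σ, trace ℝ E (signedSum H σ ^ (2 * p)) ≤
      Module.finrank ℝ E * (p * ∑ i, c i ^ 2) ^ p := by
  induction p with
  | zero => simp
  | succ p ih =>
    set V := ∑ i, c i ^ 2
    have hV : 0 ≤ V := Finset.sum_nonneg fun i _ => sq_nonneg _
    calc 𝔼 σ, trace ℝ E (signedSum H σ ^ (2 * (p + 1)))
        ≤ (((2 * p : ℕ) : ℝ) + 1) * V * 𝔼 σ, trace ℝ E (signedSum H σ ^ (2 * p)) :=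
          expect_trace_signedSum_pow_add_two_le hH hc (even_two_mul p)
      _ ≤ (((2 * p : ℕ) : ℝ) + 1) * V * (Module.finrank ℝ E * (p * V) ^ p) := by gcongr
      _ = ((2 * (p : ℝ) + 1) * p ^ p) * (Module.finrank ℝ E * V ^ (p + 1)) := by
          push_cast
          ring
      _ ≤ (p + 1 : ℝ) ^ (p + 1) * (Module.finrank ℝ E * V ^ (p + 1)) := by
          gcongr
          exact two_mul_add_one_mul_pow_le p
      _ = Module.finrank ℝ E * (((p + 1 : ℕ) : ℝ) * V) ^ (p + 1) := by
          rw [mul_pow]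
          push_cast
          ring

theorem expect_norm_signedSum_sq_pow_le {H : ι → E →L[ℝ] E}
    (hH : ∀ i, (H i : E →ₗ[ℝ] E).IsSymmetric) {p : ℕ} (hp : p ≠ 0) :
    (𝔼 σ, ‖signedSum H σ‖ ^ 2) ^ p ≤ Module.finrank ℝ E * (p * ∑ i, ‖H i‖ ^ 2) ^ p := by
  have hcoe : ∀ σ, ((signedSum H σ : E →L[ℝ] E) : E →ₗ[ℝ] E) =
      signedSum (fun i => (H i : E →ₗ[ℝ] E)) σ := by
    intro σ
    ext x
    simp [signedSum, LinearMap.sum_apply, Units.smul_def]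
  have hjensen : (𝔼 σ, ‖signedSum H σ‖ ^ 2) ^ p ≤ 𝔼 σ, (‖signedSum H σ‖ ^ 2) ^ p := by
    simpa only [Fintype.expect_eq_sum_div_card, div_eq_inv_mul, Finset.mul_sum] using
      Real.pow_arith_mean_le_arith_mean_pow Finset.univ
        (fun _ => (Fintype.card (ι → ℤˣ) : ℝ)⁻¹) (fun σ => ‖signedSum H σ‖ ^ 2)
        (fun _ _ => by positivity) (by simp) (fun _ _ => by positivity) p
  refine hjensen.trans ((Finset.expect_le_expect fun σ _ => ?_).trans
    (expect_trace_signedSum_pow_le hH (fun i => (H i).le_opNorm) p))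
  rw [← hcoe]
  exact opNorm_sq_pow_le_trace (by rw [hcoe]; exact signedSum_isSymmetric hH σ) hp

/-- The exponent at which the moment bound is optimal up to a constant is `⌈log n⌉`, for which
`n ^ (1 / p) ≤ e`; dimension two is treated apart to keep the constant small. -/
theorem exists_moment_exponent {n : ℕ} (hn : 2 ≤ n) :
    ∃ (p : ℕ) (b : ℝ), p ≠ 0 ∧ 0 ≤ b ∧ n ≤ b ^ p ∧ b * p ≤ 11 / 2 * Real.log n := by
  rcases hn.eq_or_lt with rfl | hn3
  · exact ⟨1, 2, one_ne_zero, zero_le_two, by norm_num,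
      by norm_num; linarith [Real.log_two_gt_d9]⟩
  have hn0 : (0 : ℝ) < n := by positivity
  have hlog : 1 < Real.log n := by
    rw [Real.lt_log_iff_exp_lt hn0]
    have hn3' : (3 : ℝ) ≤ n := by exact_mod_cast hn3
    linarith [Real.exp_one_lt_d9]
  have hceil : (⌈Real.log n⌉₊ : ℝ) ≤ 2 * Real.log n := by
    linarith [Nat.ceil_lt_add_one (zero_le_one.trans hlog.le)]
  refine ⟨⌈Real.log n⌉₊, Real.exp 1, (Nat.ceil_pos.2 (one_pos.trans hlog)).ne',
    (Real.exp_pos 1).le, ?_, ?_⟩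
  · rw [← Real.exp_nat_mul, mul_one, ← Real.log_le_iff_le_exp hn0]
    exact Nat.le_ceil _
  · calc Real.exp 1 * ⌈Real.log n⌉₊ ≤ 2.75 * (2 * Real.log n) := by
          gcongr
          linarith [Real.exp_one_lt_d9]
      _ = 11 / 2 * Real.log n := by ring

theorem expect_norm_signedSum_sq_le {H : ι → E →L[ℝ] E}
    (hH : ∀ i, (H i : E →ₗ[ℝ] E).IsSymmetric) (hE : 2 ≤ Module.finrank ℝ E) :
    𝔼 σ, ‖signedSum H σ‖ ^ 2 ≤ 11 / 2 * Real.log (Module.finrank ℝ E) * ∑ i, ‖H i‖ ^ 2 := by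
  have hV : 0 ≤ ∑ i, ‖H i‖ ^ 2 := Finset.sum_nonneg fun i _ => sq_nonneg _
  obtain ⟨p, b, hp, hb, hdim, hbp⟩ := exists_moment_exponent hE
  refine (le_of_pow_le_pow_left₀ hp (by positivity) ?_).trans (mul_le_mul_of_nonneg_right hbp hV)
  calc (𝔼 σ, ‖signedSum H σ‖ ^ 2) ^ p
      ≤ Module.finrank ℝ E * (p * ∑ i, ‖H i‖ ^ 2) ^ p := expect_norm_signedSum_sq_pow_le hH hp
    _ ≤ b ^ p * (p * ∑ i, ‖H i‖ ^ 2) ^ p := by gcongr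
    _ = (b * p * ∑ i, ‖H i‖ ^ 2) ^ p := by rw [← mul_pow, mul_assoc]

end Khintchine

/-! ### Second moments of sums of independent samples -/

section SampleSums

open scoped BigOperators

theorem memLp_two_sub_const {Ω V : Type*} [MeasurableSpace Ω] {μ : Measure Ω}
    [NormedAddCommGroup V] {Z : Ω → V} {v : V} (hZ : AEStronglyMeasurable Z μ)
    (hv : Integrable (fun ω => ‖Z ω - v‖ ^ 2) μ) : MemLp (fun ω => Z ω - v) 2 μ :=
  (memLp_two_iff_integrable_sq_norm (hZ.sub aestronglyMeasurable_const)).2 hv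

section Moments

variable {Ω V : Type*} [MeasurableSpace Ω] {μ : Measure Ω} [IsProbabilityMeasure μ]
  [NormedAddCommGroup V] {Z : Ω → V}

theorem sq_integral_norm_le (hZ : MemLp Z 2 μ) : (∫ ω, ‖Z ω‖ ∂μ) ^ 2 ≤ ∫ ω, ‖Z ω‖ ^ 2 ∂μ := by
  have hvar := variance_nonneg (fun ω => ‖Z ω‖) μ
  rw [variance_eq_sub hZ.norm] at hvar
  exact sub_nonneg.1 hvar

theorem integral_norm_le_of_integral_norm_sq_le (hZ : MemLp Z 2 μ) {b : ℝ} (hb : 0 ≤ b)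
    (h : ∫ ω, ‖Z ω‖ ^ 2 ∂μ ≤ b ^ 2) : ∫ ω, ‖Z ω‖ ∂μ ≤ b :=
  le_of_sq_le_sq ((sq_integral_norm_le hZ).trans h) hb

theorem sq_norm_integral_le [NormedSpace ℝ V] (hZ : MemLp Z 2 μ) :
    ‖∫ ω, Z ω ∂μ‖ ^ 2 ≤ ∫ ω, ‖Z ω‖ ^ 2 ∂μ :=
  (pow_le_pow_left₀ (norm_nonneg _) (norm_integral_le_integral_norm Z) 2).trans
    (sq_integral_norm_le hZ)

theorem integral_norm_sq_sub_le (hZ : MemLp Z 2 μ) :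
    ∫ p, ‖Z p.1 - Z p.2‖ ^ 2 ∂(μ.prod μ) ≤ 4 * ∫ ω, ‖Z ω‖ ^ 2 ∂μ := by
  have hsq : Integrable (fun ω => ‖Z ω‖ ^ 2) μ := hZ.integrable_norm_pow two_ne_zero
  have hfst : Integrable (fun p : Ω × Ω => ‖Z p.1‖ ^ 2) (μ.prod μ) := hsq.comp_fst _
  have hsnd : Integrable (fun p : Ω × Ω => ‖Z p.2‖ ^ 2) (μ.prod μ) := hsq.comp_snd _
  calc ∫ p, ‖Z p.1 - Z p.2‖ ^ 2 ∂(μ.prod μ)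
      ≤ ∫ p : Ω × Ω, (2 * ‖Z p.1‖ ^ 2 + 2 * ‖Z p.2‖ ^ 2) ∂(μ.prod μ) := by
        refine integral_mono_of_nonneg (.of_forall fun p => sq_nonneg _)
          ((hfst.const_mul 2).add (hsnd.const_mul 2)) (.of_forall fun p => ?_)
        calc ‖Z p.1 - Z p.2‖ ^ 2 ≤ (‖Z p.1‖ + ‖Z p.2‖) ^ 2 := by gcongr; exact norm_sub_le _ _
          _ ≤ 2 * (‖Z p.1‖ ^ 2 + ‖Z p.2‖ ^ 2) := add_sq_le
          _ = 2 * ‖Z p.1‖ ^ 2 + 2 * ‖Z p.2‖ ^ 2 := mul_add _ _ _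
    _ = 4 * ∫ ω, ‖Z ω‖ ^ 2 ∂μ := by
        rw [integral_add (hfst.const_mul 2) (hsnd.const_mul 2), integral_const_mul,
          integral_const_mul, integral_fun_fst (fun ω => ‖Z ω‖ ^ 2),
          integral_fun_snd (fun ω => ‖Z ω‖ ^ 2), probReal_univ, one_smul]
        ring

end Moments

variable {Ξ : Type*} [MeasurableSpace Ξ] {D : Measure Ξ} [IsProbabilityMeasure D]
  {ι : Type*} [Fintype ι] {V : Type*} [NormedAddCommGroup V] {Y : Ξ → V}

theorem memLp_eval {p : ENNReal} (hY : MemLp Y p D) (i : ι) :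
    MemLp (fun s : ι → Ξ => Y (s i)) p (Measure.pi fun _ => D) :=
  hY.comp_measurePreserving (measurePreserving_eval (fun _ : ι => D) i)

theorem memLp_sum_eval {p : ENNReal} (hY : MemLp Y p D) :
    MemLp (fun s : ι → Ξ => ∑ i, Y (s i)) p (Measure.pi fun _ => D) :=
  memLp_finsetSum _ fun i _ => memLp_eval hY i

theorem memLp_signedSum_eval {p : ENNReal} (hY : MemLp Y p D) (σ : ι → ℤˣ) :
    MemLp (fun s : ι → Ξ => signedSum (fun i => Y (s i)) σ) p (Measure.pi fun _ => D) := by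
  refine memLp_finsetSum _ fun i _ => ?_
  rcases Int.units_eq_one_or (σ i) with h | h
  · simpa only [h, one_smul] using memLp_eval hY i
  · simp only [h, Units.neg_smul, one_smul]
    exact (memLp_eval hY i).neg

theorem integral_sum_eval [NormedSpace ℝ V] (hY : Integrable Y D) :
    ∫ s : ι → Ξ, ∑ i, Y (s i) ∂(Measure.pi fun _ => D) = Fintype.card ι • ∫ ξ, Y ξ ∂D := by
  rw [integral_finsetSum _ fun i _ => integrable_comp_eval hY]
  simp [integral_comp_eval (μ := fun _ : ι => D) hY.aestronglyMeasurable]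

section Hilbert

variable [InnerProductSpace ℝ V]

theorem integrable_inner_of_memLp {Ω : Type*} [MeasurableSpace Ω] {μ : Measure Ω} {Z W : Ω → V}
    (hZ : MemLp Z 2 μ) (hW : MemLp W 2 μ) : Integrable (fun ω => inner ℝ (Z ω) (W ω)) μ := by
  refine ((hZ.integrable_norm_pow two_ne_zero).add (hW.integrable_norm_pow two_ne_zero)).mono'
    (hZ.aestronglyMeasurable.inner hW.aestronglyMeasurable) (.of_forall fun ω => ?_)
  calc ‖inner ℝ (Z ω) (W ω)‖ ≤ ‖Z ω‖ * ‖W ω‖ := norm_inner_le_norm _ _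
    _ ≤ ‖Z ω‖ ^ 2 + ‖W ω‖ ^ 2 := by
      nlinarith [two_mul_le_add_sq ‖Z ω‖ ‖W ω‖, norm_nonneg (Z ω), norm_nonneg (W ω)]

variable [CompleteSpace V] [MeasurableSpace V] [BorelSpace V]

theorem integral_inner_eval_eq_zero (hY : Integrable Y D) (hY0 : ∫ ξ, Y ξ ∂D = 0) {i j : ι}
    (hij : i ≠ j) :
    ∫ s : ι → Ξ, inner ℝ (Y (s i)) (Y (s j)) ∂(Measure.pi fun _ => D) = 0 := by
  have hindep := (iIndepFun_pi (μ := fun _ : ι => D) (X := fun _ => Y)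
    (fun _ => hY.aestronglyMeasurable.aemeasurable)).indepFun hij
  refine (hindep.integral_bilin (integrable_comp_eval hY) (integrable_comp_eval hY)
    (innerSL ℝ : V →L[ℝ] V →L[ℝ] ℝ)).trans ?_
  rw [integral_comp_eval (μ := fun _ : ι => D) (i := i) hY.aestronglyMeasurable, hY0, map_zero,
    zero_apply]

theorem integral_norm_sq_sum_eval (hY : MemLp Y 2 D) (hY0 : ∫ ξ, Y ξ ∂D = 0) :
    ∫ s : ι → Ξ, ‖∑ i, Y (s i)‖ ^ 2 ∂(Measure.pi fun _ => D) =
      Fintype.card ι * ∫ ξ, ‖Y ξ‖ ^ 2 ∂D := by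
  have hint : ∀ i j : ι, Integrable (fun s : ι → Ξ => inner ℝ (Y (s i)) (Y (s j)))
      (Measure.pi fun _ => D) :=
    fun i j => integrable_inner_of_memLp (memLp_eval hY i) (memLp_eval hY j)
  have hrow : ∀ i : ι, ∑ j, ∫ s : ι → Ξ, inner ℝ (Y (s i)) (Y (s j)) ∂(Measure.pi fun _ => D)
      = ∫ ξ, ‖Y ξ‖ ^ 2 ∂D := by
    intro i
    rw [Fintype.sum_eq_single i fun j hj =>
      integral_inner_eval_eq_zero (hY.integrable one_le_two) hY0 hj.symm]
    simp only [real_inner_self_eq_norm_sq]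
    exact integral_comp_eval (μ := fun _ : ι => D) (f := fun ξ => ‖Y ξ‖ ^ 2)
      (hY.integrable_norm_pow two_ne_zero).aestronglyMeasurable
  have hexpand : ∀ s : ι → Ξ, ‖∑ i, Y (s i)‖ ^ 2 = ∑ i, ∑ j, inner ℝ (Y (s i)) (Y (s j)) := by
    intro s
    rw [← real_inner_self_eq_norm_sq, sum_inner]
    exact Finset.sum_congr rfl fun i _ => inner_sum _ _ _
  simp only [hexpand]
  rw [integral_finsetSum _ fun i _ => integrable_finsetSum _ fun j _ => hint i j]
  simp only [integral_finsetSum _ fun j _ => hint _ j, hrow, Finset.sum_const, Finset.card_univ,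
    nsmul_eq_mul]

end Hilbert

/-- Subtracting an independent centred copy can only increase the second moment, by Jensen's
inequality in the copy. -/
theorem integral_norm_sq_sum_eval_le_pairs [NormedSpace ℝ V] [CompleteSpace V] (hY : MemLp Y 2 D)
    (hY0 : ∫ ξ, Y ξ ∂D = 0) :
    ∫ s : ι → Ξ, ‖∑ i, Y (s i)‖ ^ 2 ∂(Measure.pi fun _ => D) ≤
      ∫ w : ι → Ξ × Ξ, ‖∑ i, (Y (w i).1 - Y (w i).2)‖ ^ 2 ∂(Measure.pi fun _ => D.prod D) := by
  set μ : Measure (ι → Ξ) := Measure.pi fun _ => D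
  set S : (ι → Ξ) → V := fun s => ∑ i, Y (s i) with hS
  have hS_mem : MemLp S 2 μ := memLp_sum_eval hY
  have hS_int : Integrable S μ := hS_mem.integrable one_le_two
  have hS0 : ∫ s, S s ∂μ = 0 := by
    rw [hS, integral_sum_eval (hY.integrable one_le_two), hY0, smul_zero]
  have hjensen : ∀ s, ‖S s‖ ^ 2 ≤ ∫ s', ‖S s - S s'‖ ^ 2 ∂μ := by
    intro s
    have hsq := sq_norm_integral_le (Z := fun s' => S s - S s') ((memLp_const (S s)).sub hS_mem)
    rwa [integral_sub (integrable_const _) hS_int, hS0, sub_zero, integral_const, probReal_univ,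
      one_smul] at hsq
  have hdiff : Integrable (fun p : (ι → Ξ) × (ι → Ξ) => ‖S p.1 - S p.2‖ ^ 2) (μ.prod μ) :=
    ((hS_mem.comp_measurePreserving measurePreserving_fst).sub
      (hS_mem.comp_measurePreserving measurePreserving_snd)).integrable_norm_pow two_ne_zero
  calc ∫ s, ‖S s‖ ^ 2 ∂μ ≤ ∫ s, ∫ s', ‖S s - S s'‖ ^ 2 ∂μ ∂μ :=
        integral_mono (hS_mem.integrable_norm_pow two_ne_zero) hdiff.integral_prod_left hjensen
    _ = ∫ p, ‖S p.1 - S p.2‖ ^ 2 ∂(μ.prod μ) := (integral_prod _ hdiff).symm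
    _ = ∫ w : ι → Ξ × Ξ, ‖∑ i, Y (w i).1 - ∑ i, Y (w i).2‖ ^ 2 ∂(Measure.pi fun _ => D.prod D) :=
        ((measurePreserving_arrowProdEquivProdArrow Ξ Ξ ι (fun _ => D)
          (fun _ => D)).integral_comp' _).symm
    _ = _ := by simp only [Finset.sum_sub_distrib]

/-- Exchanging the two members of a pair flips the sign of their difference. -/
theorem integral_norm_sq_signedSum_pairs (σ : ι → ℤˣ) :
    ∫ w : ι → Ξ × Ξ, ‖signedSum (fun i => Y (w i).1 - Y (w i).2) σ‖ ^ 2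
        ∂(Measure.pi fun _ => D.prod D) =
      ∫ w : ι → Ξ × Ξ, ‖∑ i, (Y (w i).1 - Y (w i).2)‖ ^ 2 ∂(Measure.pi fun _ => D.prod D) := by
  let exchange : ι → Ξ × Ξ ≃ᵐ Ξ × Ξ := fun i =>
    if σ i = 1 then MeasurableEquiv.refl _ else MeasurableEquiv.prodComm
  have hexchange : ∀ i, MeasurePreserving (exchange i) (D.prod D) (D.prod D) := by
    intro i
    simp only [exchange]
    split
    · exact MeasurePreserving.id _
    · exact Measure.measurePreserving_swap
  have hpi := measurePreserving_pi (fun _ : ι => D.prod D) (fun _ : ι => D.prod D) hexchange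
  rw [← hpi.integral_comp (MeasurableEquiv.piCongrRight exchange).measurableEmbedding]
  refine integral_congr_ae (.of_forall fun w => ?_)
  simp only [signedSum]
  congr 2
  refine Finset.sum_congr rfl fun i _ => ?_
  rcases Int.units_eq_one_or (σ i) with h | h
  · simp [exchange, h]
  · have hne : (-1 : ℤˣ) ≠ 1 := by decide
    simp only [exchange, h, if_neg hne, Units.neg_smul, one_smul, neg_sub]
    rfl

/-- Once symmetrized, the sum may be averaged over all sign patterns, and Khintchine's inequality
applies pointwise. -/
theorem integral_opNorm_sq_sum_eval_le {E : Type*} [NormedAddCommGroup E] [InnerProductSpace ℝ E]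
    [FiniteDimensional ℝ E] (hE : 2 ≤ Module.finrank ℝ E) {A : Ξ → E →L[ℝ] E} (hA : MemLp A 2 D)
    (hA0 : ∫ ξ, A ξ ∂D = 0) (hsymm : ∀ ξ, (A ξ : E →ₗ[ℝ] E).IsSymmetric) :
    ∫ s : ι → Ξ, ‖∑ i, A (s i)‖ ^ 2 ∂(Measure.pi fun _ => D) ≤
      22 * Real.log (Module.finrank ℝ E) * (Fintype.card ι * ∫ ξ, ‖A ξ‖ ^ 2 ∂D) := by
  classical
  set B : Ξ × Ξ → E →L[ℝ] E := fun z => A z.1 - A z.2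
  set ν : Measure (ι → Ξ × Ξ) := Measure.pi fun _ => D.prod D
  have hB : MemLp B 2 (D.prod D) :=
    (hA.comp_measurePreserving measurePreserving_fst).sub
      (hA.comp_measurePreserving measurePreserving_snd)
  have hB_symm : ∀ z, (B z : E →ₗ[ℝ] E).IsSymmetric := fun z => (hsymm z.1).sub (hsymm z.2)
  have hB_sq : ∀ i : ι, Integrable (fun w : ι → Ξ × Ξ => ‖B (w i)‖ ^ 2) ν :=
    fun i => (memLp_eval hB i).integrable_norm_pow two_ne_zero
  have hsigned : ∀ σ : ι → ℤˣ, Integrable (fun w => ‖signedSum (fun i => B (w i)) σ‖ ^ 2) ν :=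
    fun σ => (memLp_signedSum_eval hB σ).integrable_norm_pow two_ne_zero
  have hlog : 0 ≤ Real.log (Module.finrank ℝ E) := Real.log_natCast_nonneg _
  calc ∫ s : ι → Ξ, ‖∑ i, A (s i)‖ ^ 2 ∂(Measure.pi fun _ => D)
      ≤ ∫ w, ‖∑ i, B (w i)‖ ^ 2 ∂ν := integral_norm_sq_sum_eval_le_pairs hA hA0
    _ = 𝔼 σ : ι → ℤˣ, ∫ w, ‖signedSum (fun i => B (w i)) σ‖ ^ 2 ∂ν := by
        rw [Finset.expect_congr rfl fun σ _ => integral_norm_sq_signedSum_pairs σ,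
          Fintype.expect_const]
    _ = ∫ w, 𝔼 σ : ι → ℤˣ, ‖signedSum (fun i => B (w i)) σ‖ ^ 2 ∂ν := by
        simp only [Fintype.expect_eq_sum_div_card]
        rw [integral_div, integral_finsetSum _ fun σ _ => hsigned σ]
    _ ≤ ∫ w, 11 / 2 * Real.log (Module.finrank ℝ E) * ∑ i, ‖B (w i)‖ ^ 2 ∂ν :=
        integral_mono_of_nonneg (.of_forall fun w => Finset.expect_nonneg fun σ _ => sq_nonneg _)
          ((integrable_finsetSum _ fun i _ => hB_sq i).const_mul _)
          (.of_forall fun w => expect_norm_signedSum_sq_le (fun i => hB_symm (w i)) hE)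
    _ = 11 / 2 * Real.log (Module.finrank ℝ E) *
          (Fintype.card ι * ∫ z, ‖B z‖ ^ 2 ∂(D.prod D)) := by
        rw [integral_const_mul, integral_sum_eval (hB.integrable_norm_pow two_ne_zero),
          nsmul_eq_mul]
    _ ≤ 11 / 2 * Real.log (Module.finrank ℝ E) *
          (Fintype.card ι * (4 * ∫ ξ, ‖A ξ‖ ^ 2 ∂D)) := by
        gcongr
        exact integral_norm_sq_sub_le hA
    _ = 22 * Real.log (Module.finrank ℝ E) * (Fintype.card ι * ∫ ξ, ‖A ξ‖ ^ 2 ∂D) := by ring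

/-- The factor `κ` is the price of orthogonality: it is one in a Hilbert space. -/
theorem integral_norm_average_sub_le [NormedSpace ℝ V] {m : ℕ} {κ η b : ℝ} {v : V}
    (hY : AEStronglyMeasurable Y D) (hv : Integrable (fun ξ => ‖Y ξ - v‖ ^ 2) D)
    (hsum : ∫ s : Fin m → Ξ, ‖∑ i, (Y (s i) - v)‖ ^ 2 ∂(Measure.pi fun _ => D) ≤
      κ * (m * ∫ ξ, ‖Y ξ - v‖ ^ 2 ∂D))
    (hvar : ∫ ξ, ‖Y ξ - v‖ ^ 2 ∂D ≤ b ^ 2) (hη : 0 < η) (hb : 0 ≤ b) (hκ : 0 < κ)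
    (hm : κ / η ^ 2 ≤ m) :
    Integrable (fun s : Fin m → Ξ => ‖(1 / (m : ℝ)) • ∑ i, Y (s i) - v‖)
      (Measure.pi fun _ => D) ∧
    ∫ s : Fin m → Ξ, ‖(1 / (m : ℝ)) • ∑ i, Y (s i) - v‖ ∂(Measure.pi fun _ => D) ≤ η * b := by
  have hm0 : (0 : ℝ) < m := (div_pos hκ (pow_pos hη 2)).trans_le hm
  have hcentre : ∀ s : Fin m → Ξ,
      (1 / (m : ℝ)) • ∑ i, Y (s i) - v = (1 / (m : ℝ)) • ∑ i, (Y (s i) - v) := by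
    intro s
    rw [Finset.sum_sub_distrib, smul_sub, Finset.sum_const, Finset.card_univ, Fintype.card_fin,
      ← Nat.cast_smul_eq_nsmul ℝ, smul_smul, one_div_mul_cancel hm0.ne', one_smul]
  have hmem : MemLp (fun s : Fin m → Ξ => (1 / (m : ℝ)) • ∑ i, (Y (s i) - v)) 2
      (Measure.pi fun _ => D) :=
    (memLp_sum_eval (memLp_two_sub_const hY hv)).const_smul (1 / (m : ℝ))
  simp only [hcentre]
  refine ⟨(hmem.integrable one_le_two).norm,
    integral_norm_le_of_integral_norm_sq_le hmem (by positivity) ?_⟩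
  simp only [norm_smul, mul_pow, integral_const_mul, Real.norm_of_nonneg (one_div_pos.2 hm0).le]
  calc (1 / (m : ℝ)) ^ 2 * ∫ s : Fin m → Ξ, ‖∑ i, (Y (s i) - v)‖ ^ 2 ∂(Measure.pi fun _ => D)
      ≤ (1 / (m : ℝ)) ^ 2 * (κ * (m * ∫ ξ, ‖Y ξ - v‖ ^ 2 ∂D)) := by gcongr
    _ = κ / m * ∫ ξ, ‖Y ξ - v‖ ^ 2 ∂D := by field_simp
    _ ≤ η ^ 2 * b ^ 2 := by
        gcongr
        rwa [div_le_iff₀ hm0, ← div_le_iff₀' (pow_pos hη 2)]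

end SampleSums

/-! ### Batch derivatives -/

section Batch

variable {n : ℕ} {Ξ : Type*} {f : Vec n → Ξ → ℝ}

theorem gradient_batch (hf : ∀ ξ, Differentiable ℝ fun x => f x ξ) {m : ℕ} (S : Fin m → Ξ)
    (x : Vec n) :
    gradient (batch f S) x = (1 / (m : ℝ)) • ∑ i, gradient (fun y => f y (S i)) x := by
  have hderiv : HasFDerivAt (batch f S)
      ((1 / (m : ℝ)) • ∑ i, fderiv ℝ (fun y => f y (S i)) x) x :=
    (HasFDerivAt.fun_sum fun i _ => (hf (S i) x).hasFDerivAt).const_mul _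
  rw [gradient, hderiv.fderiv, map_smul, map_sum]
  rfl

theorem hasFDerivAt_gradient_batch (hf : ∀ ξ, TwiceDifferentiable fun x => f x ξ) {m : ℕ}
    (S : Fin m → Ξ) (x : Vec n) :
    HasFDerivAt (gradient (batch f S))
      ((1 / (m : ℝ)) • ∑ i, hessian (fun y => f y (S i)) x) x := by
  rw [funext (gradient_batch (fun ξ => (hf ξ).1) S)]
  exact (HasFDerivAt.fun_sum fun i _ => ((hf (S i)).2 x).hasFDerivAt).const_smul (1 / (m : ℝ))

theorem hessian_batch (hf : ∀ ξ, TwiceDifferentiable fun x => f x ξ) {m : ℕ} (S : Fin m → Ξ)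
    (x : Vec n) :
    hessian (batch f S) x = (1 / (m : ℝ)) • ∑ i, hessian (fun y => f y (S i)) x :=
  (hasFDerivAt_gradient_batch hf S x).fderiv

theorem twiceDifferentiable_batch (hf : ∀ ξ, TwiceDifferentiable fun x => f x ξ) {m : ℕ}
    (S : Fin m → Ξ) : TwiceDifferentiable (batch f S) :=
  ⟨(Differentiable.fun_sum fun i _ => (hf (S i)).1).const_mul _,
    fun x => (hasFDerivAt_gradient_batch hf S x).differentiableAt⟩

end Batch

section BatchMeasurability

theorem measurable_of_measurable_clm_apply {α E V : Type*} [MeasurableSpace α]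
    [NormedAddCommGroup E] [InnerProductSpace ℝ E] [FiniteDimensional ℝ E]
    [NormedAddCommGroup V] [NormedSpace ℝ V] [MeasurableSpace V] [BorelSpace V]
    [SecondCountableTopology V] {L : α → E →L[ℝ] V} (hL : ∀ v, Measurable fun a => L a v) :
    Measurable L := by
  let b := stdOrthonormalBasis ℝ E
  have hexpand : L = fun a =>
      ∑ i, ContinuousLinearMap.smulRightL ℝ E V (innerSL ℝ (b i)) (L a (b i)) := by
    funext a
    refine ContinuousLinearMap.ext fun v => ?_
    conv_lhs => rw [← b.sum_repr' v, map_sum]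
    simp [sum_apply]
  rw [hexpand]
  exact Finset.measurable_fun_sum _ fun i _ =>
    (ContinuousLinearMap.continuous _).measurable.comp (hL (b i))

variable {n : ℕ} {Ξ : Type*} [MeasurableSpace Ξ]

theorem measurable_fderiv_of_measurable_param {V : Type*} [NormedAddCommGroup V] [NormedSpace ℝ V]
    [MeasurableSpace V] [BorelSpace V] [SecondCountableTopology V] {h : Vec n → Ξ → V}
    (hmeas : ∀ x, Measurable (h x)) (hdiff : ∀ ξ, Differentiable ℝ fun x => h x ξ) :
    Measurable fun p : Vec n × Ξ => fderiv ℝ (fun x => h x p.2) p.1 := by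
  refine measurable_of_measurable_clm_apply fun v => ?_
  have hjoint : Measurable (Function.uncurry h) :=
    measurable_uncurry_of_continuous_of_measurable (fun ξ => (hdiff ξ).continuous) hmeas
  refine measurable_of_tendsto_metrizable
    (f := fun (k : ℕ) (p : Vec n × Ξ) =>
      (k : ℝ) • (h (p.1 + (k : ℝ)⁻¹ • v) p.2 - h p.1 p.2)) (fun k => ?_) ?_
  · have hshift : Measurable fun p : Vec n × Ξ => h (p.1 + (k : ℝ)⁻¹ • v) p.2 :=
      hjoint.comp ((measurable_fst.add_const _).prodMk measurable_snd)
    exact (hshift.sub hjoint).const_smul (k : ℝ)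
  · refine tendsto_pi_nhds.2 fun p => (hdiff p.2 p.1).hasFDerivAt.lim v ?_
    simpa using tendsto_natCast_atTop_atTop

variable {f : Vec n → Ξ → ℝ}

theorem StochasticComponent.measurable_gradient (hf : StochasticComponent f) :
    Measurable fun p : Vec n × Ξ => gradient (fun x => f x p.2) p.1 :=
  (LinearIsometryEquiv.continuous _).measurable.comp
    (measurable_fderiv_of_measurable_param hf.1 fun ξ => (hf.2 ξ).1)

theorem StochasticComponent.measurable_hessian (hf : StochasticComponent f) :
    Measurable fun p : Vec n × Ξ => hessian (fun x => f x p.2) p.1 :=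
  measurable_fderiv_of_measurable_param
    (fun _ => hf.measurable_gradient.comp measurable_prodMk_left) fun ξ => (hf.2 ξ).2

theorem measurable_sum_comp_eval {α V : Type*} [MeasurableSpace α] [AddCommMonoid V]
    [MeasurableSpace V] [MeasurableAdd₂ V] {h : α × Ξ → V} (hh : Measurable h) (m : ℕ) :
    Measurable fun p : α × (Fin m → Ξ) => ∑ i, h (p.1, p.2 i) :=
  Finset.measurable_fun_sum _ fun i _ =>
    hh.comp (measurable_fst.prodMk ((measurable_pi_apply i).comp measurable_snd))

theorem measurable_gradient_batch (hf : StochasticComponent f) (m : ℕ) :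
    Measurable fun p : Vec n × (Fin m → Ξ) => gradient (batch f p.2) p.1 := by
  simp only [gradient_batch fun ξ => (hf.2 ξ).1]
  exact (measurable_sum_comp_eval hf.measurable_gradient m).const_smul (1 / (m : ℝ))

theorem measurable_hessian_batch (hf : StochasticComponent f) (m : ℕ) :
    Measurable fun p : Vec n × (Fin m → Ξ) => hessian (batch f p.2) p.1 := by
  simp only [hessian_batch hf.2]
  exact (measurable_sum_comp_eval hf.measurable_hessian m).const_smul (1 / (m : ℝ))

end BatchMeasurability

section BatchError

variable {n : ℕ} {Ξ : Type*} [MeasurableSpace Ξ] {D : Measure Ξ} [IsProbabilityMeasure D]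
  {f : Vec n → Ξ → ℝ} {F : Vec n → ℝ}

theorem integral_sub_const_eq_zero {V : Type*} [NormedAddCommGroup V] [NormedSpace ℝ V]
    [CompleteSpace V] {Y : Ξ → V} {v : V} (hY : Integrable Y D) (hv : ∫ ξ, Y ξ ∂D = v) :
    ∫ ξ, (Y ξ - v) ∂D = 0 := by
  rw [integral_sub hY (integrable_const _), hv, integral_const, probReal_univ, one_smul, sub_self]

theorem sq_add_sq_mul_le_add_mul_sq {a b u : ℝ} (ha : 0 ≤ a) (hb : 0 ≤ b) (hu : 0 ≤ u) :
    a ^ 2 + b ^ 2 * u ^ 2 ≤ (a + b * u) ^ 2 := by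
  nlinarith [mul_nonneg ha (mul_nonneg hb hu)]

theorem GradientVarianceBounded.integral_norm_gradient_batch_sub_le {G₀ G₁ η : ℝ} {m : ℕ}
    (hv : GradientVarianceBounded D f F G₀ G₁) (hf : ∀ ξ, Differentiable ℝ fun x => f x ξ)
    (hG₀ : 0 ≤ G₀) (hG₁ : 0 ≤ G₁) (hη : 0 < η) (hm : 1 / η ^ 2 ≤ m) (x : Vec n) :
    Integrable (fun s : Fin m → Ξ => ‖gradient (batch f s) x - gradient F x‖)
      (Measure.pi fun _ => D) ∧
    ∫ s : Fin m → Ξ, ‖gradient (batch f s) x - gradient F x‖ ∂(Measure.pi fun _ => D) ≤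
      η * (G₀ + G₁ * ‖gradient F x‖) := by
  obtain ⟨hint, hmean, hsq, hvar⟩ := hv x
  set Y : Ξ → Vec n := fun ξ => gradient (fun y => f y ξ) x
  have hsum : ∫ s : Fin m → Ξ, ‖∑ i, (Y (s i) - gradient F x)‖ ^ 2 ∂(Measure.pi fun _ => D) ≤
      1 * (m * ∫ ξ, ‖Y ξ - gradient F x‖ ^ 2 ∂D) := by
    rw [integral_norm_sq_sum_eval (memLp_two_sub_const hint.aestronglyMeasurable hsq)
      (integral_sub_const_eq_zero hint hmean), Fintype.card_fin, one_mul]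
  have herror := integral_norm_average_sub_le hint.aestronglyMeasurable hsq hsum
    (hvar.trans (sq_add_sq_mul_le_add_mul_sq hG₀ hG₁ (norm_nonneg _))) hη (by positivity)
    one_pos hm
  simpa only [gradient_batch hf] using herror

theorem HessianVarianceBounded.integral_norm_hessian_batch_sub_le {K₀ K₁ η : ℝ} {m : ℕ}
    (hv : HessianVarianceBounded D f F K₀ K₁) (hn : 2 ≤ n)
    (hf : ∀ ξ, TwiceDifferentiable fun x => f x ξ) (hF : TwiceDifferentiable F)
    (hK₀ : 0 ≤ K₀) (hK₁ : 0 ≤ K₁) (hη : 0 < η) (hm : 22 * Real.log n / η ^ 2 ≤ m) (x : Vec n) :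
    Integrable (fun s : Fin m → Ξ => ‖hessian (batch f s) x - hessian F x‖)
      (Measure.pi fun _ => D) ∧
    ∫ s : Fin m → Ξ, ‖hessian (batch f s) x - hessian F x‖ ∂(Measure.pi fun _ => D) ≤
      η * (K₀ + K₁ * ‖gradient F x‖) := by
  obtain ⟨hint, hmean, hsq, hvar⟩ := hv x
  set A : Ξ → Vec n →L[ℝ] Vec n := fun ξ => hessian (fun y => f y ξ) x
  have hlog : 0 < Real.log n := Real.log_pos (by exact_mod_cast hn)
  have hsum : ∫ s : Fin m → Ξ, ‖∑ i, (A (s i) - hessian F x)‖ ^ 2 ∂(Measure.pi fun _ => D) ≤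
      22 * Real.log n * (m * ∫ ξ, ‖A ξ - hessian F x‖ ^ 2 ∂D) := by
    have hsymm := fun ξ => ((hf ξ).hessian_isSymmetric x).sub (hF.hessian_isSymmetric x)
    have hfinrank : Module.finrank ℝ (Vec n) = n := finrank_euclideanSpace_fin
    have hkhintchine := integral_opNorm_sq_sum_eval_le (ι := Fin m) (hfinrank.symm ▸ hn)
      (memLp_two_sub_const hint.aestronglyMeasurable hsq)
      (integral_sub_const_eq_zero hint hmean) hsymm
    rwa [hfinrank, Fintype.card_fin] at hkhintchine
  have herror := integral_norm_average_sub_le hint.aestronglyMeasurable hsq hsum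
    (hvar.trans (sq_add_sq_mul_le_add_mul_sq hK₀ hK₁ (norm_nonneg _))) hη (by positivity)
    (by positivity) hm
  simpa only [hessian_batch hf] using herror

end BatchError

/-! ### Runs of the method -/

section Freezing

variable {Ω α β : Type*} [MeasurableSpace Ω] [MeasurableSpace α] [MeasurableSpace β]
  {P : Measure Ω} {U : Ω → α} {Z : Ω → β} {Φ : α → β → ℝ} {b : α → ℝ}

theorem integrable_uncurry_prod_of_integral_le {μ : Measure α} {ν : Measure β} [SFinite ν]
    (hΦ : Measurable (Function.uncurry Φ)) (hΦ0 : ∀ a z, 0 ≤ Φ a z)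
    (hint : ∀ a, Integrable (Φ a) ν) (hle : ∀ a, ∫ z, Φ a z ∂ν ≤ b a) (hb : Integrable b μ) :
    Integrable (Function.uncurry Φ) (μ.prod ν) := by
  rw [integrable_prod_iff hΦ.aestronglyMeasurable]
  refine ⟨.of_forall hint, hb.mono' hΦ.aestronglyMeasurable.norm.integral_prod_right'
    (.of_forall fun a => ?_)⟩
  simp only [Function.uncurry_apply_pair, Real.norm_of_nonneg (hΦ0 a _)]
  rw [Real.norm_of_nonneg (integral_nonneg (hΦ0 a))]
  exact hle a

variable [IsFiniteMeasure P]

theorem integral_comp_le_of_indepFun (hU : Measurable U) (hZ : Measurable Z)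
    (hind : IndepFun U Z P) (hΦ : Measurable (Function.uncurry Φ)) (hΦ0 : ∀ a z, 0 ≤ Φ a z)
    (hint : ∀ a, Integrable (Φ a) (P.map Z)) (hle : ∀ a, ∫ z, Φ a z ∂(P.map Z) ≤ b a)
    (hb : Integrable b (P.map U)) :
    Integrable (fun ω => Φ (U ω) (Z ω)) P ∧ ∫ ω, Φ (U ω) (Z ω) ∂P ≤ ∫ ω, b (U ω) ∂P := by
  have hjoint : P.map (fun ω => (U ω, Z ω)) = (P.map U).prod (P.map Z) :=
    hind.map_prod_eq_prod_map_map hU.aemeasurable hZ.aemeasurable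
  have hUZ : AEMeasurable (fun ω => (U ω, Z ω)) P := (hU.prodMk hZ).aemeasurable
  have hprod : Integrable (Function.uncurry Φ) ((P.map U).prod (P.map Z)) :=
    integrable_uncurry_prod_of_integral_le hΦ hΦ0 hint hle hb
  refine ⟨(integrable_map_measure hΦ.aestronglyMeasurable hUZ).1 (hjoint ▸ hprod), ?_⟩
  calc ∫ ω, Φ (U ω) (Z ω) ∂P = ∫ p, Function.uncurry Φ p ∂(P.map fun ω => (U ω, Z ω)) :=
        (integral_map hUZ hΦ.aestronglyMeasurable).symm
    _ = ∫ a, ∫ z, Φ a z ∂(P.map Z) ∂(P.map U) := by rw [hjoint]; exact integral_prod _ hprod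
    _ ≤ ∫ a, b a ∂(P.map U) := integral_mono hprod.integral_prod_left hb hle
    _ = ∫ ω, b (U ω) ∂P := integral_map hU.aemeasurable hb.aestronglyMeasurable

end Freezing

section Errors

variable {n : ℕ} {Ξ Ω : Type*} {T m₁ m₂ : ℕ} (f : Vec n → Ξ → ℝ) (F : Vec n → ℝ)
  (S : Fin T → IterSample m₁ m₂ → Ω → Ξ) (X : Fin (T + 1) → Ω → Vec n)

/-- The error `‖g_t - ∇F(x_t)‖` of the batch gradient in iteration `t`. -/
noncomputable def gradientError (t : Fin T) (ω : Ω) : ℝ :=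
  ‖gradient (batch f fun i => S t (Sum.inl i) ω) (X t.castSucc ω) - gradient F (X t.castSucc ω)‖

/-- The error `‖H_t - ∇²F(x_t)‖` of the batch Hessian in iteration `t`. -/
noncomputable def hessianError (t : Fin T) (ω : Ω) : ℝ :=
  ‖hessian (batch f fun i => S t (Sum.inr i) ω) (X t.castSucc ω) - hessian F (X t.castSucc ω)‖

end Errors

namespace IsSOTRGSRun

variable {n : ℕ} {Ξ Ω : Type*} [MeasurableSpace Ξ] [mΩ : MeasurableSpace Ω] {P : Measure Ω}
  {D : Measure Ξ} {f : Vec n → Ξ → ℝ} {F : Vec n → ℝ} {x₀ : Vec n} {r : ℝ} {T m₁ m₂ : ℕ}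
  {ℱ : Filtration (Fin (T + 1)) mΩ} {S : Fin T → IterSample m₁ m₂ → Ω → Ξ}
  {X : Fin (T + 1) → Ω → Vec n}

theorem measurable_iterate (h : IsSOTRGSRun P D f F x₀ r T m₁ m₂ ℱ S X) (t : Fin (T + 1)) :
    Measurable (X t) :=
  (h.iterate_known t).mono (ℱ.le t) le_rfl

theorem measurable_sample (h : IsSOTRGSRun P D f F x₀ r T m₁ m₂ ℱ S X) (t : Fin T)
    (i : IterSample m₁ m₂) : Measurable (S t i) :=
  (h.sample_known t i).mono (ℱ.le t.succ) le_rfl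

theorem norm_iterate_sub_le (h : IsSOTRGSRun P D f F x₀ r T m₁ m₂ ℱ S X) (t : Fin (T + 1))
    (ω : Ω) : ‖X t ω - x₀‖ ≤ t.val * r := by
  induction t using Fin.induction with
  | zero => simp [h.init ω]
  | succ t ih =>
    obtain ⟨d, hd, hX⟩ := h.step t ω
    calc ‖X t.succ ω - x₀‖ = ‖(X t.castSucc ω - x₀) + d‖ := by rw [hX, add_sub_right_comm]
      _ ≤ t.val * r + r := norm_add_le_of_le ih hd.1
      _ = t.succ.val * r := by rw [Fin.val_succ]; push_cast; ring

theorem indepFun_iterate_sample (h : IsSOTRGSRun P D f F x₀ r T m₁ m₂ ℱ S X) (t : Fin T)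
    {κ : Type*} (j : κ → IterSample m₁ m₂) :
    IndepFun (X t.castSucc) (fun ω i => S t (j i) ω) P := by
  have hfresh : IndepFun (X t.castSucc) (fun ω i => S t i ω) P := (IndepFun_iff_Indep _ _ _).2
    (indep_of_indep_of_le_left (h.sample_fresh t) (h.iterate_known t.castSucc).comap_le)
  exact hfresh.comp measurable_id
    (measurable_pi_lambda (fun (s : IterSample m₁ m₂ → Ξ) (i : κ) => s (j i))
      fun i => measurable_pi_apply (j i))

theorem map_sample (h : IsSOTRGSRun P D f F x₀ r T m₁ m₂ ℱ S X) (t : Fin T) {κ : Type*}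
    [Fintype κ] {j : κ → IterSample m₁ m₂} (hj : Function.Injective j) :
    P.map (fun ω i => S t (j i) ω) = Measure.pi fun _ => D := by
  rw [((h.sample_iIndep t).precomp hj).map_fun_eq_pi_map
    fun i => (h.measurable_sample t (j i)).aemeasurable]
  simp only [h.sample_law t]

section

variable [IsFiniteMeasure P]

/-- The iterates of a run are bounded, because all steps are. -/
theorem integrable_comp_iterate (h : IsSOTRGSRun P D f F x₀ r T m₁ m₂ ℱ S X) (t : Fin (T + 1))
    {φ : Vec n → ℝ} (hφ : Continuous φ) : Integrable (fun ω => φ (X t ω)) P := by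
  obtain ⟨C, hC⟩ := (isCompact_closedBall x₀ (t.val * r)).exists_bound_of_continuousOn
    hφ.continuousOn
  exact Integrable.of_bound (hφ.measurable.comp (h.measurable_iterate t)).aestronglyMeasurable C
    (.of_forall fun ω => hC _ (mem_closedBall_iff_norm.2 (h.norm_iterate_sub_le t ω)))

/-- A bound that holds in expectation over a fresh batch at every fixed point also holds at the
random current iterate, which does not depend on that batch. -/
theorem integral_comp_iterate_sample_le (h : IsSOTRGSRun P D f F x₀ r T m₁ m₂ ℱ S X)
    (t : Fin T) {κ : Type*} [Fintype κ] {j : κ → IterSample m₁ m₂} (hj : Function.Injective j)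
    {Φ : Vec n → (κ → Ξ) → ℝ} {b : Vec n → ℝ} (hΦ : Measurable (Function.uncurry Φ))
    (hΦ0 : ∀ x s, 0 ≤ Φ x s) (hb : Continuous b)
    (hΦb : ∀ x, Integrable (Φ x) (Measure.pi fun _ => D) ∧
      ∫ s, Φ x s ∂(Measure.pi fun _ => D) ≤ b x) :
    Integrable (fun ω => Φ (X t.castSucc ω) fun i => S t (j i) ω) P ∧
      ∫ ω, Φ (X t.castSucc ω) (fun i => S t (j i) ω) ∂P ≤ ∫ ω, b (X t.castSucc ω) ∂P := by
  have hX := h.measurable_iterate t.castSucc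
  have hmap := h.map_sample t hj
  exact integral_comp_le_of_indepFun hX
    (measurable_pi_lambda _ fun i => h.measurable_sample t (j i))
    (h.indepFun_iterate_sample t j) hΦ hΦ0 (fun x => hmap ▸ (hΦb x).1)
    (fun x => hmap ▸ (hΦb x).2)
    ((integrable_map_measure hb.measurable.aestronglyMeasurable hX.aemeasurable).2
      (h.integrable_comp_iterate t.castSucc hb))

end

variable [IsProbabilityMeasure P]

theorem integral_affine_norm_gradient (h : IsSOTRGSRun P D f F x₀ r T m₁ m₂ ℱ S X)
    (hgrad : Continuous (gradient F)) (t : Fin (T + 1)) (a b : ℝ) :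
    ∫ ω, (a + b * ‖gradient F (X t ω)‖) ∂P = a + b * ∫ ω, ‖gradient F (X t ω)‖ ∂P := by
  rw [integral_add (integrable_const a) ((h.integrable_comp_iterate t hgrad.norm).const_mul b),
    integral_const_mul, integral_const, probReal_univ, one_smul]

section SampleErrors

variable [IsProbabilityMeasure D]

theorem integral_gradientError_le (h : IsSOTRGSRun P D f F x₀ r T m₁ m₂ ℱ S X)
    (hf : StochasticComponent f) (hgrad : Continuous (gradient F)) {G₀ G₁ η : ℝ}
    (hG₀ : 0 ≤ G₀) (hG₁ : 0 ≤ G₁) (hvar : GradientVarianceBounded D f F G₀ G₁) (hη : 0 < η)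
    (hm₁ : 1 / η ^ 2 ≤ m₁) (t : Fin T) :
    Integrable (gradientError f F S X t) P ∧ ∫ ω, gradientError f F S X t ω ∂P ≤
      η * (G₀ + G₁ * ∫ ω, ‖gradient F (X t.castSucc ω)‖ ∂P) := by
  rw [← h.integral_affine_norm_gradient hgrad, ← integral_const_mul]
  exact h.integral_comp_iterate_sample_le t Sum.inl_injective
    (Φ := fun x s => ‖gradient (batch f s) x - gradient F x‖)
    (b := fun x => η * (G₀ + G₁ * ‖gradient F x‖))
    ((measurable_gradient_batch hf m₁).sub (hgrad.measurable.comp measurable_fst)).norm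
    (fun _ _ => norm_nonneg _) (by fun_prop)
    (hvar.integral_norm_gradient_batch_sub_le (fun ξ => (hf.2 ξ).1) hG₀ hG₁ hη hm₁)

theorem integral_hessianError_le (h : IsSOTRGSRun P D f F x₀ r T m₁ m₂ ℱ S X) (hn : 2 ≤ n)
    (hf : StochasticComponent f) (hF : TwiceDifferentiable F) (hhess : Continuous (hessian F))
    {K₀ K₁ η : ℝ} (hK₀ : 0 ≤ K₀) (hK₁ : 0 ≤ K₁) (hvar : HessianVarianceBounded D f F K₀ K₁)
    (hη : 0 < η) (hm₂ : 22 * Real.log n / η ^ 2 ≤ m₂) (t : Fin T) :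
    Integrable (hessianError f F S X t) P ∧ ∫ ω, hessianError f F S X t ω ∂P ≤
      η * (K₀ + K₁ * ∫ ω, ‖gradient F (X t.castSucc ω)‖ ∂P) := by
  have hgrad : Continuous (gradient F) := hF.2.continuous
  rw [← h.integral_affine_norm_gradient hgrad, ← integral_const_mul]
  exact h.integral_comp_iterate_sample_le t Sum.inr_injective
    (Φ := fun x s => ‖hessian (batch f s) x - hessian F x‖)
    (b := fun x => η * (K₀ + K₁ * ‖gradient F x‖))
    ((measurable_hessian_batch hf m₂).sub (hhess.measurable.comp measurable_fst)).norm
    (fun _ _ => norm_nonneg _) (by fun_prop)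
    (hvar.integral_norm_hessian_batch_sub_le hn hf.2 hF hK₀ hK₁ hη hm₂)

end SampleErrors

end IsSOTRGSRun

/-! ### Averaging over the run -/

/-- The coefficient of `r ^ 3` in the expected descent inequality, for the constants `G`, `K` of
the gradient and Hessian samples and `M` of the Taylor remainder. Index `0` gives the constant
part and index `1` the part proportional to `‖∇F(x_t)‖`; the factor `θ` depends on the quantity
that is estimated. -/
noncomputable def descentRate (θ G K M : ℝ) : ℝ := 3 / 2 * G + K + θ * M

theorem sum_le_of_forall_descent {T : ℕ} {v u : Fin (T + 1) → ℝ} {w : Fin T → ℝ} {A B : ℝ}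
    (hB : 0 ≤ B) (hu : 0 ≤ u (Fin.last T))
    (hstep : ∀ t : Fin T, v t.succ - v t.castSucc + w t ≤ A + B * u t.castSucc) :
    ∑ t, w t ≤ v 0 - v (Fin.last T) + T * A + B * (u 0 + ∑ t : Fin T, u t.succ) := by
  have hv : ∑ t : Fin T, (v t.succ - v t.castSucc) = v (Fin.last T) - v 0 := by
    rw [Finset.sum_sub_distrib]
    linarith [Fin.sum_univ_succ v, Fin.sum_univ_castSucc v]
  have hu_shift : ∑ t : Fin T, u t.castSucc ≤ u 0 + ∑ t : Fin T, u t.succ := by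
    linarith [Fin.sum_univ_succ u, Fin.sum_univ_castSucc u]
  have hsum := Finset.sum_le_sum fun t (_ : t ∈ Finset.univ) => hstep t
  rw [Finset.sum_add_distrib, Finset.sum_add_distrib, hv, ← Finset.mul_sum, Finset.sum_const,
    Finset.card_univ, Fintype.card_fin, nsmul_eq_mul] at hsum
  linarith [mul_le_mul_of_nonneg_left hu_shift hB]

section UniformIndex

variable {n T : ℕ} {Ω : Type*} [MeasurableSpace Ω] {P : Measure Ω} {X : Fin (T + 1) → Ω → Vec n}
  {τ : Ω → Fin T}

theorem IsUniformIndex.measureReal_eq (hτ : IsUniformIndex P X τ) (k : Fin T) :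
    P.real (τ ⁻¹' {k}) = (T : ℝ)⁻¹ := by
  have hk : P (τ ⁻¹' {k}) = (T : ENNReal)⁻¹ := hτ.2.1 k
  rw [measureReal_def, hk, ENNReal.toReal_inv, ENNReal.toReal_natCast]

theorem IsUniformIndex.integral_comp (hτ : IsUniformIndex P X τ) {φ : Vec n → ℝ}
    (hφ : Measurable φ) [IsFiniteMeasure P] (hint : ∀ t, Integrable (fun ω => φ (X t ω)) P) :
    Integrable (fun ω => φ (X (τ ω).succ ω)) P ∧
      ∫ ω, φ (X (τ ω).succ ω) ∂P = (∑ t : Fin T, ∫ ω, φ (X t.succ ω) ∂P) / T := by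
  have hset : ∀ k, MeasurableSet (τ ⁻¹' {k}) := fun k => hτ.1 (measurableSet_singleton k)
  have hone : ∀ k, Integrable ((τ ⁻¹' {k}).indicator (1 : Ω → ℝ)) P := fun k =>
    (integrable_const 1).indicator (hset k)
  have hindep : ∀ k : Fin T,
      IndepFun ((τ ⁻¹' {k}).indicator (1 : Ω → ℝ)) (fun ω => φ (X k.succ ω)) P := fun k =>
    hτ.2.2.comp (φ := Set.indicator {k} (1 : Fin T → ℝ)) (measurable_of_finite _)
      (hφ.comp (measurable_pi_apply k.succ))
  have hexpand : (fun ω => φ (X (τ ω).succ ω)) =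
      fun ω => ∑ k, (τ ⁻¹' {k}).indicator (1 : Ω → ℝ) ω * φ (X k.succ ω) := by
    funext ω
    rw [Fintype.sum_eq_single (τ ω) fun k hk => by simp [hk.symm]]
    simp
  have hterm : ∀ k : Fin T,
      Integrable (fun ω => (τ ⁻¹' {k}).indicator (1 : Ω → ℝ) ω * φ (X k.succ ω)) P := fun k =>
    (hindep k).integrable_mul (hone k) (hint k.succ)
  rw [hexpand]
  refine ⟨integrable_finsetSum _ fun k _ => hterm k, ?_⟩
  rw [integral_finsetSum _ fun k _ => hterm k, Finset.sum_div]
  refine Finset.sum_congr rfl fun k _ => ?_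
  rw [(hindep k).integral_fun_mul_eq_mul_integral (hone k).aestronglyMeasurable
    (hint k.succ).aestronglyMeasurable, integral_indicator_one (hset k), hτ.measureReal_eq,
    inv_mul_eq_div]

end UniformIndex

namespace IsSOTRGSRun

variable {n : ℕ} {Ξ Ω : Type*} [MeasurableSpace Ξ] [mΩ : MeasurableSpace Ω] {P : Measure Ω}
  [IsProbabilityMeasure P] {D : Measure Ξ} {f : Vec n → Ξ → ℝ} {F : Vec n → ℝ} {x₀ : Vec n}
  {r : ℝ} {T m₁ m₂ : ℕ} {ℱ : Filtration (Fin (T + 1)) mΩ}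
  {S : Fin T → IterSample m₁ m₂ → Ω → Ξ} {X : Fin (T + 1) → Ω → Vec n} {τ : Ω → Fin T}
  {G₀ G₁ K₀ K₁ M₀ M₁ : ℝ}

theorem integrable_comp_output (h : IsSOTRGSRun P D f F x₀ r T m₁ m₂ ℱ S X)
    (hτ : IsUniformIndex P X τ) {φ : Vec n → ℝ} (hφ : Continuous φ) :
    Integrable (fun ω => φ (X (τ ω).succ ω)) P :=
  (hτ.integral_comp hφ.measurable fun t => h.integrable_comp_iterate t hφ).1

theorem integral_comp_output (h : IsSOTRGSRun P D f F x₀ r T m₁ m₂ ℱ S X)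
    (hτ : IsUniformIndex P X τ) {φ : Vec n → ℝ} (hφ : Continuous φ) :
    ∫ ω, φ (X (τ ω).succ ω) ∂P = (∑ t : Fin T, ∫ ω, φ (X t.succ ω) ∂P) / T :=
  (hτ.integral_comp hφ.measurable fun t => h.integrable_comp_iterate t hφ).2

theorem integral_comp_output_le (h : IsSOTRGSRun P D f F x₀ r T m₁ m₂ ℱ S X)
    (hτ : IsUniformIndex P X τ) (hT : 0 < T) (hF : Continuous F)
    (hgrad : Continuous (gradient F)) (hbdd : BddBelow (Set.range F)) {φ : Vec n → ℝ}
    (hφ : Continuous φ) {A B : ℝ} (hB : 0 ≤ B)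
    (hstep : ∀ t : Fin T, ∫ ω, F (X t.succ ω) ∂P - ∫ ω, F (X t.castSucc ω) ∂P +
      ∫ ω, φ (X t.succ ω) ∂P ≤ A + B * ∫ ω, ‖gradient F (X t.castSucc ω)‖ ∂P) :
    ∫ ω, φ (X (τ ω).succ ω) ∂P ≤ initialGap F x₀ / T + A +
      B * (‖gradient F x₀‖ / T + ∫ ω, ‖gradient F (X (τ ω).succ ω)‖ ∂P) := by
  have hT0 : (0 : ℝ) < T := Nat.cast_pos.2 hT
  have hinit : ∀ ψ : Vec n → ℝ, ∫ ω, ψ (X 0 ω) ∂P = ψ x₀ := fun ψ => by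
    simp only [h.init, integral_const, probReal_univ, one_smul]
  have hlast : ⨅ x, F x ≤ ∫ ω, F (X (Fin.last T) ω) ∂P := by
    simpa only [integral_const, probReal_univ, one_smul] using
      integral_mono (integrable_const (μ := P) (⨅ x, F x))
        (h.integrable_comp_iterate (Fin.last T) hF) fun ω => ciInf_le hbdd (X (Fin.last T) ω)
  have hsum := sum_le_of_forall_descent (v := fun t => ∫ ω, F (X t ω) ∂P)
    (u := fun t => ∫ ω, ‖gradient F (X t ω)‖ ∂P) (w := fun t => ∫ ω, φ (X t.succ ω) ∂P) hB
    (integral_nonneg fun ω => norm_nonneg _) hstep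
  simp only [hinit F, hinit fun x => ‖gradient F x‖] at hsum
  rw [h.integral_comp_output hτ hφ, h.integral_comp_output hτ hgrad.norm, ← add_div,
    div_add' _ _ _ hT0.ne', mul_div_assoc', ← add_div]
  refine div_le_div_of_nonneg_right ?_ hT0.le
  rw [initialGap]
  linarith

theorem integral_descent_le (h : IsSOTRGSRun P D f F x₀ r T m₁ m₂ ℱ S X) (hr : 0 ≤ r)
    (hF : Continuous F) (hgrad : Continuous (gradient F)) {φ : Vec n → ℝ} (hφ : Continuous φ)
    {θ : ℝ} (t : Fin T)
    (hg : Integrable (gradientError f F S X t) P ∧ ∫ ω, gradientError f F S X t ω ∂P ≤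
      r ^ 2 * (G₀ + G₁ * ∫ ω, ‖gradient F (X t.castSucc ω)‖ ∂P))
    (hh : Integrable (hessianError f F S X t) P ∧ ∫ ω, hessianError f F S X t ω ∂P ≤
      r * (K₀ + K₁ * ∫ ω, ‖gradient F (X t.castSucc ω)‖ ∂P))
    (hdescent : ∀ ω, F (X t.succ ω) - F (X t.castSucc ω) + φ (X t.succ ω) ≤
      3 / 2 * r * gradientError f F S X t ω + r ^ 2 * hessianError f F S X t ω +
        θ * (M₀ + M₁ * ‖gradient F (X t.castSucc ω)‖) * r ^ 3) :
    ∫ ω, F (X t.succ ω) ∂P - ∫ ω, F (X t.castSucc ω) ∂P + ∫ ω, φ (X t.succ ω) ∂P ≤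
      r ^ 3 * descentRate θ G₀ K₀ M₀ +
        r ^ 3 * descentRate θ G₁ K₁ M₁ * ∫ ω, ‖gradient F (X t.castSucc ω)‖ ∂P := by
  have hFint := fun s => h.integrable_comp_iterate s hF
  have hφint := h.integrable_comp_iterate t.succ hφ
  have hdecrease : Integrable (fun ω => F (X t.succ ω) - F (X t.castSucc ω)) P :=
    (hFint t.succ).sub (hFint t.castSucc)
  have herror : Integrable (fun ω => 3 / 2 * r * gradientError f F S X t ω +
      r ^ 2 * hessianError f F S X t ω) P := (hg.1.const_mul _).add (hh.1.const_mul _)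
  have haffine : Integrable (fun ω => θ * (M₀ + M₁ * ‖gradient F (X t.castSucc ω)‖) * r ^ 3) P :=
    h.integrable_comp_iterate t.castSucc
      (φ := fun x => θ * (M₀ + M₁ * ‖gradient F x‖) * r ^ 3) (by fun_prop)
  have hmean := integral_mono (hdecrease.add hφint) (herror.add haffine) hdescent
  simp only [Pi.add_apply] at hmean
  rw [integral_add hdecrease hφint, integral_sub (hFint t.succ) (hFint t.castSucc),
    integral_add herror haffine,
    integral_add (hg.1.const_mul _) (hh.1.const_mul _), integral_const_mul, integral_const_mul,
    integral_mul_const, integral_const_mul, h.integral_affine_norm_gradient hgrad] at hmean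
  have hg_scaled := mul_le_mul_of_nonneg_left hg.2 (by positivity : 0 ≤ 3 / 2 * r)
  have hh_scaled := mul_le_mul_of_nonneg_left hh.2 (sq_nonneg r)
  rw [descentRate, descentRate]
  linarith

end IsSOTRGSRun

theorem descentRate_nonneg {θ G K M : ℝ} (hθ : 0 ≤ θ) (hG : 0 ≤ G) (hK : 0 ≤ K) (hM : 0 ≤ M) :
    0 ≤ descentRate θ G K M := by
  unfold descentRate
  positivity

namespace IsSOTRGSRun

variable {n : ℕ} {Ξ Ω : Type*} [MeasurableSpace Ξ] [mΩ : MeasurableSpace Ω] {P : Measure Ω}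
  [IsProbabilityMeasure P] {D : Measure Ξ} [IsProbabilityMeasure D] {f : Vec n → Ξ → ℝ}
  {F : Vec n → ℝ} {x₀ : Vec n} {r : ℝ} {T m₁ m₂ : ℕ} {ℱ : Filtration (Fin (T + 1)) mΩ}
  {S : Fin T → IterSample m₁ m₂ → Ω → Ξ} {X : Fin (T + 1) → Ω → Vec n} {τ : Ω → Fin T}
  {G₀ G₁ K₀ K₁ M₀ M₁ : ℝ}

theorem integral_comp_output_le_of_descent (h : IsSOTRGSRun P D f F x₀ r T m₁ m₂ ℱ S X)
    (hτ : IsUniformIndex P X τ) (hn : 2 ≤ n) (hr : 0 < r) (hf : StochasticComponent f)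
    (hbdd : BddBelow (Set.range F)) (hF : TwiceDifferentiable F)
    (hhess : Continuous (hessian F)) (hvarG : GradientVarianceBounded D f F G₀ G₁)
    (hvarK : HessianVarianceBounded D f F K₀ K₁) (hG₀ : 0 ≤ G₀) (hG₁ : 0 ≤ G₁) (hK₀ : 0 ≤ K₀)
    (hK₁ : 0 ≤ K₁) (hM₁ : 0 ≤ M₁) (hm₁ : 1 / (r ^ 2) ^ 2 ≤ m₁)
    (hm₂ : 22 * Real.log n / r ^ 2 ≤ m₂) {φ : Vec n → ℝ} (hφ : Continuous φ) {θ : ℝ}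
    (hθ : 0 ≤ θ)
    (hdescent : ∀ {x g d : Vec n} {B : Vec n →L[ℝ] Vec n},
      (B : Vec n →ₗ[ℝ] Vec n).IsSymmetric → IsTRSolution (F x) g B r d →
        F (x + d) - F x + φ (x + d) ≤
          3 / 2 * r * ‖g - gradient F x‖ + r ^ 2 * ‖B - hessian F x‖ +
            θ * (M₀ + M₁ * ‖gradient F x‖) * r ^ 3) :
    ∫ ω, φ (X (τ ω).succ ω) ∂P ≤ initialGap F x₀ / T + r ^ 3 * descentRate θ G₀ K₀ M₀ +
      r ^ 3 * descentRate θ G₁ K₁ M₁ *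
        (‖gradient F x₀‖ / T + ∫ ω, ‖gradient F (X (τ ω).succ ω)‖ ∂P) := by
  obtain ⟨ω₀⟩ := nonempty_of_isProbabilityMeasure P
  have hcont : Continuous F := hF.1.continuous
  have hgrad : Continuous (gradient F) := hF.2.continuous
  have hgradError := h.integral_gradientError_le hf hgrad hG₀ hG₁ hvarG (pow_pos hr 2) hm₁
  have hhessError := h.integral_hessianError_le hn hf hF hhess hK₀ hK₁ hvarK hr hm₂
  refine h.integral_comp_output_le hτ (τ ω₀).pos hcont hgrad hbdd hφ
    (mul_nonneg (pow_pos hr 3).le (descentRate_nonneg hθ hG₁ hK₁ hM₁)) fun t =>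
    h.integral_descent_le hr.le hcont hgrad hφ t (hgradError t) (hhessError t) fun ω => ?_
  obtain ⟨d, hd, hX⟩ := h.step t ω
  rw [hX]
  exact hdescent ((twiceDifferentiable_batch hf.2 _).hessian_isSymmetric _) hd

theorem averaged_descent (h : IsSOTRGSRun P D f F x₀ r T m₁ m₂ ℱ S X)
    (hτ : IsUniformIndex P X τ) (hn : 2 ≤ n) (hr : 0 < r) (hf : StochasticComponent f)
    (hbdd : BddBelow (Set.range F)) (hF : SecondOrderGeneralizedSmooth F r M₀ M₁)
    (hvarG : GradientVarianceBounded D f F G₀ G₁) (hvarK : HessianVarianceBounded D f F K₀ K₁)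
    (hG₀ : 0 ≤ G₀) (hG₁ : 0 ≤ G₁) (hK₀ : 0 ≤ K₀) (hK₁ : 0 ≤ K₁) (hM₀ : 0 ≤ M₀) (hM₁ : 0 ≤ M₁)
    (hm₁ : 1 / (r ^ 2) ^ 2 ≤ m₁) (hm₂ : 22 * Real.log n / r ^ 2 ≤ m₂) :
    1 / 2 * r * ∫ ω, ‖gradient F (X (τ ω).succ ω)‖ ∂P ≤
        initialGap F x₀ / T + r ^ 3 * descentRate (5 / 12) G₀ K₀ M₀ +
          r ^ 3 * descentRate (5 / 12) G₁ K₁ M₁ *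
            (‖gradient F x₀‖ / T + ∫ ω, ‖gradient F (X (τ ω).succ ω)‖ ∂P) ∧
      -(1 / 2 * r ^ 2 * ∫ ω, lambdaMin (hessian F (X (τ ω).succ ω)) ∂P) ≤
        initialGap F x₀ / T + r ^ 3 * descentRate (2 / 3) G₀ K₀ M₀ +
          r ^ 3 * descentRate (2 / 3) G₁ K₁ M₁ *
            (‖gradient F x₀‖ / T + ∫ ω, ‖gradient F (X (τ ω).succ ω)‖ ∂P) := by
  have haverage := fun {φ : Vec n → ℝ} (hφ : Continuous φ) {θ : ℝ} (hθ : 0 ≤ θ) =>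
    h.integral_comp_output_le_of_descent hτ hn hr hf hbdd hF.1 (hF.continuous_hessian hr) hvarG
      hvarK hG₀ hG₁ hK₀ hK₁ hM₁ hm₁ hm₂ (M₀ := M₀) hφ hθ
  have hgrad : Continuous (gradient F) := hF.1.2.continuous
  constructor
  · rw [← integral_const_mul]
    exact haverage (φ := fun x => 1 / 2 * r * ‖gradient F x‖) (by fun_prop) (by norm_num)
      fun hB hd => hd.descent_gradient hF hM₀ hM₁ hB
  · rw [← integral_const_mul, ← integral_neg]
    refine haverage (φ := fun x => -(1 / 2 * r ^ 2 * lambdaMin (hessian F x)))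
      ((hF.continuous_lambdaMin_hessian (by lia) hr).const_mul _).neg (by norm_num)
      fun _ hd => ?_
    rw [← sub_eq_add_neg]
    exact hd.descent_curvature (by lia) hF hM₀ hM₁

end IsSOTRGSRun

/-! ### The complexity bound -/

section Arithmetic

variable {r c a A L₀ gap g₀ : ℝ}

theorem mul_le_add_one_of_mul_sq_le_one (ha : 0 ≤ a) (har : a * r ^ 2 ≤ 1) : a * r ≤ a + 1 := by
  nlinarith [mul_nonneg ha (sq_nonneg (r - 1))]

theorem mul_initial_gradient_le (hr : 0 < r) (hc : 0 < c) (ha : 0 ≤ a) (hL₀ : 0 ≤ L₀)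
    (har : a * r ^ 2 ≤ 1) (hgap : gap ≤ r ^ 3 / c) (hg₀ : g₀ ≤ 2 * gap / r + L₀ * r) :
    a * g₀ ≤ 2 / c + L₀ * (a + 1) :=
  calc a * g₀ ≤ a * (2 * (r ^ 3 / c) / r + L₀ * r) := by gcongr; exact hg₀.trans (by gcongr)
    _ = 2 / c * (a * r ^ 2) + L₀ * (a * r) := by field_simp
    _ ≤ 2 / c * 1 + L₀ * (a + 1) := by
        gcongr
        exact mul_le_add_one_of_mul_sq_le_one ha har
    _ = 2 / c + L₀ * (a + 1) := by rw [mul_one]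

theorem gradient_le_of_averaged_descent {G : ℝ} (hr : 0 < r) (hc : 0 < c) (ha : 0 ≤ a)
    (hL₀ : 0 ≤ L₀) (hG : 0 ≤ G) (har : a * r ^ 2 ≤ 3 / 8) (hgap : gap ≤ r ^ 3 / c)
    (hg₀ : g₀ ≤ 2 * gap / r + L₀ * r)
    (hdescent : 1 / 2 * r * G ≤ gap + r ^ 3 * A + r ^ 3 * a * (g₀ + G)) :
    G ≤ 8 * (3 / c + A + L₀ * (a + 1)) * r ^ 2 := by
  have hinit := mul_initial_gradient_le hr hc ha hL₀ (by linarith) hgap hg₀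
  refine le_of_mul_le_mul_left ?_ (by positivity : 0 < 1 / 8 * r)
  have habsorb : r ^ 3 * a * G ≤ 3 / 8 * (r * G) :=
    calc r ^ 3 * a * G = a * r ^ 2 * (r * G) := by ring
      _ ≤ 3 / 8 * (r * G) := by gcongr
  calc 1 / 8 * r * G ≤ gap + r ^ 3 * A + r ^ 3 * (a * g₀) := by linarith
    _ ≤ r ^ 3 / c + r ^ 3 * A + r ^ 3 * (2 / c + L₀ * (a + 1)) := by gcongr
    _ = 1 / 8 * r * (8 * (3 / c + A + L₀ * (a + 1)) * r ^ 2) := by ring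

theorem neg_curvature_le_of_averaged_descent {G C Λ : ℝ} (hr : 0 < r) (hc : 0 < c) (ha : 0 ≤ a)
    (hL₀ : 0 ≤ L₀) (hC : 0 ≤ C) (har : a * r ^ 2 ≤ 1) (hgap : gap ≤ r ^ 3 / c)
    (hg₀ : g₀ ≤ 2 * gap / r + L₀ * r) (hG : G ≤ C * r ^ 2)
    (hdescent : -(1 / 2 * r ^ 2 * Λ) ≤ gap + r ^ 3 * A + r ^ 3 * a * (g₀ + G)) :
    -(2 * (3 / c + A + L₀ * (a + 1) + C) * r) ≤ Λ := by
  have hinit := mul_initial_gradient_le hr hc ha hL₀ har hgap hg₀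
  have hgradient : a * G ≤ C :=
    calc a * G ≤ a * (C * r ^ 2) := by gcongr
      _ = C * (a * r ^ 2) := by ring
      _ ≤ C := mul_le_of_le_one_right hC har
  refine neg_le.1 (le_of_mul_le_mul_left ?_ (by positivity : 0 < 1 / 2 * r ^ 2))
  calc 1 / 2 * r ^ 2 * -Λ ≤ gap + r ^ 3 * A + r ^ 3 * (a * g₀ + a * G) := by linarith
    _ ≤ r ^ 3 / c + r ^ 3 * A + r ^ 3 * (2 / c + L₀ * (a + 1) + C) := by gcongr
    _ = 1 / 2 * r ^ 2 * (2 * (3 / c + A + L₀ * (a + 1) + C) * r) := by ring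

end Arithmetic

section Constants

variable (L₀ M₀ M₁ G₀ G₁ K₀ K₁ c : ℝ)

/-- A bound, uniform in the radius, for the constant part of the modulus of continuity of the
Hessian on the trust region. -/
noncomputable def hessianModulus : ℝ := M₀ + (M₁ + 1) * L₀

/-- The constant in `𝔼 ‖∇F(x)‖ ≤ C ε` at the output `x` of the method. -/
noncomputable def gradientConst : ℝ :=
  8 * (3 / c + descentRate (5 / 12) G₀ K₀ (hessianModulus L₀ M₀ M₁) +
    L₀ * (descentRate (5 / 12) G₁ K₁ (3 / 2 * M₁) + 1))

/-- The constant in `𝔼 λ_min(∇²F(x)) ≥ -C √ε` at the output `x` of the method. -/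
noncomputable def curvatureConst : ℝ :=
  2 * (3 / c + descentRate (2 / 3) G₀ K₀ (hessianModulus L₀ M₀ M₁) +
    L₀ * (descentRate (2 / 3) G₁ K₁ (3 / 2 * M₁) + 1) + gradientConst L₀ M₀ M₁ G₀ G₁ K₀ K₁ c)

variable {L₀ M₀ M₁ G₀ G₁ K₀ K₁ c}

theorem gradientConst_nonneg (hL₀ : 0 ≤ L₀) (hM₀ : 0 ≤ M₀) (hM₁ : 0 ≤ M₁) (hG₀ : 0 ≤ G₀)
    (hG₁ : 0 ≤ G₁) (hK₀ : 0 ≤ K₀) (hK₁ : 0 ≤ K₁) (hc : 0 ≤ c) :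
    0 ≤ gradientConst L₀ M₀ M₁ G₀ G₁ K₀ K₁ c := by
  unfold gradientConst descentRate hessianModulus
  positivity

theorem curvatureConst_nonneg (hL₀ : 0 ≤ L₀) (hM₀ : 0 ≤ M₀) (hM₁ : 0 ≤ M₁) (hG₀ : 0 ≤ G₀)
    (hG₁ : 0 ≤ G₁) (hK₀ : 0 ≤ K₀) (hK₁ : 0 ≤ K₁) (hc : 0 ≤ c) :
    0 ≤ curvatureConst L₀ M₀ M₁ G₀ G₁ K₀ K₁ c := by
  unfold curvatureConst gradientConst descentRate hessianModulus
  positivity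

theorem SecondOrderGeneralizedSmooth.extend_radius_hessianModulus {n : ℕ} {F : Vec n → ℝ}
    {L₁ δ r : ℝ} (hF : SecondOrderGeneralizedSmooth F δ M₀ M₁) (hG : GeneralizedSmooth F L₀ L₁)
    (hδ : 0 < δ) (hL₀ : 0 ≤ L₀) (hL₁ : 0 ≤ L₁) (hM₁ : 0 ≤ M₁) (hL₁r : L₁ * r ≤ 1)
    (hM₁r : M₁ * r ^ 2 ≤ 1) :
    SecondOrderGeneralizedSmooth F r (hessianModulus L₀ M₀ M₁) (3 / 2 * M₁) := by
  refine ⟨hF.1, fun x x' hxx' =>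
    ((hF.extend_radius hG hδ hL₀ hL₁ hM₁ hL₁r).2 x x' hxx').trans ?_⟩
  have hmodulus : M₀ + M₁ * L₀ * r / 2 ≤ hessianModulus L₀ M₀ M₁ := by
    have hscaled := mul_le_mul_of_nonneg_right (mul_le_add_one_of_mul_sq_le_one hM₁ hM₁r) hL₀
    have hnonneg : 0 ≤ (M₁ + 1) * L₀ := by positivity
    rw [hessianModulus]
    linarith
  gcongr

end Constants

theorem GeneralizedSmooth.norm_gradient_div_le {n : ℕ} {F : Vec n → ℝ} {L₀ L₁ r T : ℝ}
    (hF : GeneralizedSmooth F L₀ L₁) (hL₀ : 0 ≤ L₀) (hbdd : BddBelow (Set.range F)) (x₀ : Vec n)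
    (hr : 0 < r) (hL₁r : L₁ * r ≤ 1) (hT : 1 ≤ T) :
    ‖gradient F x₀‖ / T ≤ 2 * (initialGap F x₀ / T) / r + L₀ * r :=
  calc ‖gradient F x₀‖ / T ≤ (2 * initialGap F x₀ / r + L₀ * r) / T := by
        gcongr
        exact hF.norm_gradient_le_initialGap hL₀ hbdd x₀ hr hL₁r
    _ = 2 * (initialGap F x₀ / T) / r + L₀ * r / T := by ring
    _ ≤ 2 * (initialGap F x₀ / T) / r + L₀ * r := by
        gcongr
        exact div_le_self (by positivity) hT

theorem IsSOTRGSRun.integral_stationarity_le {n : ℕ} {Ξ Ω : Type*} [MeasurableSpace Ξ]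
    [mΩ : MeasurableSpace Ω] {P : Measure Ω} [IsProbabilityMeasure P] {D : Measure Ξ}
    [IsProbabilityMeasure D] {f : Vec n → Ξ → ℝ} {F : Vec n → ℝ} {x₀ : Vec n}
    {T m₁ m₂ : ℕ} {ℱ : Filtration (Fin (T + 1)) mΩ} {S : Fin T → IterSample m₁ m₂ → Ω → Ξ}
    {X : Fin (T + 1) → Ω → Vec n} {τ : Ω → Fin T} {L₀ L₁ M₀ M₁ G₀ G₁ K₀ K₁ c r δ : ℝ}
    (h : IsSOTRGSRun P D f F x₀ r T m₁ m₂ ℱ S X) (hτ : IsUniformIndex P X τ) (hn : 2 ≤ n)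
    (hf : StochasticComponent f) (hbdd : BddBelow (Set.range F))
    (hF₁ : GeneralizedSmooth F L₀ L₁) (hF₂ : SecondOrderGeneralizedSmooth F δ M₀ M₁)
    (hvarG : GradientVarianceBounded D f F G₀ G₁) (hvarK : HessianVarianceBounded D f F K₀ K₁)
    (hL₀ : 0 ≤ L₀) (hL₁ : 0 ≤ L₁) (hM₀ : 0 ≤ M₀) (hM₁ : 0 ≤ M₁) (hG₀ : 0 ≤ G₀) (hG₁ : 0 ≤ G₁)
    (hK₀ : 0 ≤ K₀) (hK₁ : 0 ≤ K₁) (hc : 0 < c) (hδ : 0 < δ) (hr : 0 < r) (hL₁r : L₁ * r ≤ 1)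
    (hrate : r ^ 2 * (5 * M₁ + 18 * G₁ + 12 * K₁) ≤ 3) (hm₁ : 1 / (r ^ 2) ^ 2 ≤ m₁)
    (hm₂ : 22 * Real.log n / r ^ 2 ≤ m₂) (hgap : initialGap F x₀ / T ≤ r ^ 3 / c) :
    ∫ ω, ‖gradient F (X (τ ω).succ ω)‖ ∂P ≤ gradientConst L₀ M₀ M₁ G₀ G₁ K₀ K₁ c * r ^ 2 ∧
      -(curvatureConst L₀ M₀ M₁ G₀ G₁ K₀ K₁ c * r) ≤
        ∫ ω, lambdaMin (hessian F (X (τ ω).succ ω)) ∂P := by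
  obtain ⟨ω₀⟩ := nonempty_of_isProbabilityMeasure P
  have hT : (1 : ℝ) ≤ T := Nat.one_le_cast.2 (τ ω₀).pos
  have hG₁r : 0 ≤ r ^ 2 * G₁ := by positivity
  have hK₁r : 0 ≤ r ^ 2 * K₁ := by positivity
  have hrateG : descentRate (5 / 12) G₁ K₁ (3 / 2 * M₁) * r ^ 2 ≤ 3 / 8 := by
    rw [descentRate]
    linarith
  have hrateΛ : descentRate (2 / 3) G₁ K₁ (3 / 2 * M₁) * r ^ 2 ≤ 1 := by
    rw [descentRate]
    linarith
  have hmod : 0 ≤ hessianModulus L₀ M₀ M₁ := by unfold hessianModulus; positivity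
  have hM : 0 ≤ 3 / 2 * M₁ := by positivity
  have hg₀ := hF₁.norm_gradient_div_le hL₀ hbdd x₀ hr hL₁r hT
  obtain ⟨hgradient, hcurvature⟩ := h.averaged_descent hτ hn hr hf hbdd
    (hF₂.extend_radius_hessianModulus hF₁ hδ hL₀ hL₁ hM₁ hL₁r (by linarith)) hvarG hvarK
    hG₀ hG₁ hK₀ hK₁ hmod hM hm₁ hm₂
  have hG := gradient_le_of_averaged_descent hr hc
    (descentRate_nonneg (by norm_num) hG₁ hK₁ hM) hL₀ (integral_nonneg fun _ => norm_nonneg _)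
    hrateG hgap hg₀ hgradient
  exact ⟨hG, neg_curvature_le_of_averaged_descent hr hc
    (descentRate_nonneg (by norm_num) hG₁ hK₁ hM) hL₀
    (gradientConst_nonneg hL₀ hM₀ hM₁ hG₀ hG₁ hK₀ hK₁ hc.le) hrateΛ hgap hg₀ hG hcurvature⟩

section SampleCount

variable {c ε gap : ℝ}

theorem gap_div_le_sqrt_pow_div {T : ℝ} (hc : 0 < c) (hε : 0 < ε) (hT₀ : 0 ≤ T)
    (hT : c * gap * ε ^ (-(3 / 2) : ℝ) ≤ T) : gap / T ≤ √ε ^ 3 / c := by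
  have hpow : ε ^ (3 / 2 : ℝ) = √ε ^ 3 := by
    rw [Real.sqrt_eq_rpow, ← Real.rpow_mul_natCast hε.le]
    norm_num
  rw [Real.rpow_neg hε.le, hpow, ← div_eq_mul_inv, div_le_iff₀ (by positivity)] at hT
  refine div_le_of_le_mul₀ hT₀ (by positivity) ?_
  rw [div_mul_eq_mul_div, le_div_iff₀ hc]
  linarith

theorem ceil_add_ceil_le {ℓ : ℝ} (hε : 0 < ε) (hε₁ : ε ≤ 1) (hℓ : 0 ≤ ℓ) :
    (⌈1 / ε ^ 2⌉₊ + ⌈ℓ / ε⌉₊ : ℝ) ≤ 3 / ε ^ 2 + ℓ / ε := by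
  have hone : 1 ≤ 1 / ε ^ 2 := one_le_one_div (by positivity) (pow_le_one₀ hε.le hε₁)
  have hgradient := Nat.ceil_lt_add_one (zero_le_one.trans hone)
  have hhessian := Nat.ceil_lt_add_one (div_nonneg hℓ hε.le)
  have hthree : 3 / ε ^ 2 = 3 * (1 / ε ^ 2) := by ring
  linarith

theorem sampleCount_le {n T m₁ m₂ : ℕ} (hε : 0 < ε) (hε₁ : ε ≤ 1)
    (hgap : ε ^ (3 / 2 : ℝ) ≤ c * gap) (hm₁ : m₁ = ⌈1 / ε ^ 2⌉₊)
    (hm₂ : m₂ = ⌈22 * Real.log n / ε⌉₊) (hT : T = ⌈c * gap * ε ^ (-(3 / 2) : ℝ)⌉₊) :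
    (sampleCount T m₁ m₂ : ℝ) ≤ 44 * c *
      (gap * ε ^ (-(7 / 2) : ℝ) + Real.log n * gap * ε ^ (-(5 / 2) : ℝ)) := by
  have hlog : 0 ≤ 22 * Real.log n := mul_nonneg (by norm_num) (Real.log_natCast_nonneg n)
  have hgap₀ : 0 ≤ c * gap := (Real.rpow_nonneg hε.le _).trans hgap
  have hiter : 1 ≤ c * gap * ε ^ (-(3 / 2) : ℝ) := by
    rwa [Real.rpow_neg hε.le, ← div_eq_mul_inv, one_le_div (Real.rpow_pos_of_pos hε _)]
  have hTle : (T : ℝ) ≤ 2 * (c * gap * ε ^ (-(3 / 2) : ℝ)) := by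
    rw [hT]
    exact Nat.ceil_le_two_mul (by linarith)
  have hbatch : (m₁ + m₂ : ℝ) ≤ 3 / ε ^ 2 + 22 * Real.log n / ε := by
    rw [hm₁, hm₂]
    exact ceil_add_ceil_le hε hε₁ hlog
  have hpow₇ : ε ^ (-(7 / 2) : ℝ) = ε ^ (-(3 / 2) : ℝ) / ε ^ 2 := by
    rw [← Real.rpow_sub_natCast hε.ne']
    norm_num
  have hpow₅ : ε ^ (-(5 / 2) : ℝ) = ε ^ (-(3 / 2) : ℝ) / ε := by
    rw [← Real.rpow_sub_one hε.ne']
    norm_num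
  have hcard : (sampleCount T m₁ m₂ : ℝ) = T * (m₁ + m₂) := by simp [sampleCount]
  calc (sampleCount T m₁ m₂ : ℝ)
      ≤ 2 * (c * gap * ε ^ (-(3 / 2) : ℝ)) * (3 / ε ^ 2 + 22 * Real.log n / ε) := by
        rw [hcard]
        gcongr
    _ = 6 * (c * gap * ε ^ (-(7 / 2) : ℝ)) +
          44 * c * (Real.log n * gap * ε ^ (-(5 / 2) : ℝ)) := by rw [hpow₇, hpow₅]; ring
    _ ≤ 44 * (c * gap * ε ^ (-(7 / 2) : ℝ)) +
          44 * c * (Real.log n * gap * ε ^ (-(5 / 2) : ℝ)) := by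
        gcongr
        norm_num
    _ = _ := by ring

end SampleCount

theorem mainTheorem2 (L₀ L₁ M₀ M₁ G₀ G₁ K₀ K₁ c : ℝ)
    (hL₀ : 0 < L₀) (hL₁ : 0 ≤ L₁) (hM₀ : 0 < M₀) (hM₁ : 0 ≤ M₁)
    (hG₀ : 0 ≤ G₀) (hG₁ : 0 ≤ G₁) (hK₀ : 0 ≤ K₀) (hK₁ : 0 ≤ K₁) (hc : 0 < c) :
    ∃ C : ℝ, 0 < C ∧
      ∀ (n : ℕ) (_ : 2 ≤ n)
        (Ξ : Type*) [MeasurableSpace Ξ] (D : Measure Ξ) [IsProbabilityMeasure D]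
        (f : Vec n → Ξ → ℝ) (F : Vec n → ℝ) (δ : ℝ) (x₀ : Vec n)
        (_ : StochasticComponent f) (_ : BddBelow (Set.range F))
        (_ : GeneralizedSmooth F L₀ L₁) (_ : GradientVarianceBounded D f F G₀ G₁)
        (_ : 0 < δ) (_ : SecondOrderGeneralizedSmooth F δ M₀ M₁)
        (_ : HessianVarianceBounded D f F K₀ K₁)
        (ε : ℝ) (_ : 0 < ε) (_ : ε * (5 * M₁ + 18 * G₁ + 12 * K₁) < 3) (_ : ε * L₁ ^ 2 < 1)
        (m₁ m₂ T : ℕ) (_ : m₁ = ⌈1 / ε ^ 2⌉₊) (_ : m₂ = ⌈22 * Real.log n / ε⌉₊)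
        (_ : T = ⌈c * initialGap F x₀ * ε ^ (-(3 / 2) : ℝ)⌉₊),
        (∀ (Ω : Type*) [mΩ : MeasurableSpace Ω] (P : Measure Ω) [IsProbabilityMeasure P]
          (ℱ : Filtration (Fin (T + 1)) mΩ) (S : Fin T → IterSample m₁ m₂ → Ω → Ξ)
          (X : Fin (T + 1) → Ω → Vec n) (τ : Ω → Fin T)
          (_ : IsSOTRGSRun P D f F x₀ (Real.sqrt ε) T m₁ m₂ ℱ S X) (_ : IsUniformIndex P X τ),
          Integrable (fun ω => ‖gradient F (X (τ ω).succ ω)‖) P ∧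
          ∫ ω, ‖gradient F (X (τ ω).succ ω)‖ ∂P ≤ C * ε ∧
          Integrable (fun ω => lambdaMin (hessian F (X (τ ω).succ ω))) P ∧
          -(C * Real.sqrt ε) ≤ ∫ ω, lambdaMin (hessian F (X (τ ω).succ ω)) ∂P) ∧
        (ε ≤ 1 → ε ^ (3 / 2 : ℝ) ≤ c * initialGap F x₀ →
          (sampleCount T m₁ m₂ : ℝ) ≤
            C * (initialGap F x₀ * ε ^ (-(7 / 2) : ℝ)
              + Real.log n * initialGap F x₀ * ε ^ (-(5 / 2) : ℝ))) := by
  have hCgrad := gradientConst_nonneg hL₀.le hM₀.le hM₁ hG₀ hG₁ hK₀ hK₁ hc.le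
  have hCcurv := curvatureConst_nonneg hL₀.le hM₀.le hM₁ hG₀ hG₁ hK₀ hK₁ hc.le
  refine ⟨_, add_pos_of_nonneg_of_pos (add_nonneg hCgrad hCcurv)
    (mul_pos (by norm_num : (0 : ℝ) < 44) hc),
    fun n hn Ξ _ D _ f F δ x₀ hf hbdd hF₁ hvarG hδ hF₂ hvarK ε hε hrate hεL₁ m₁ m₂ T hm₁ hm₂ hT =>
    ⟨fun Ω _ P _ ℱ S X τ hrun hτ => ?_, fun hε₁ hgap => ?_⟩⟩
  · have hsq : √ε ^ 2 = ε := Real.sq_sqrt hε.le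
    have hL₁ε : L₁ * √ε ≤ 1 := le_of_sq_le_sq (by rw [mul_pow, hsq]; linarith) zero_le_one
    obtain ⟨hgradient, hcurvature⟩ := hrun.integral_stationarity_le hτ hn hf hbdd hF₁ hF₂ hvarG
      hvarK hL₀.le hL₁ hM₀.le hM₁ hG₀ hG₁ hK₀ hK₁ hc hδ (Real.sqrt_pos.2 hε) hL₁ε
      (by rw [hsq]; exact hrate.le) (by rw [hsq, hm₁]; exact Nat.le_ceil _)
      (by rw [hsq, hm₂]; exact Nat.le_ceil _)
      (gap_div_le_sqrt_pow_div hc hε T.cast_nonneg (hT ▸ Nat.le_ceil _))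
    rw [hsq] at hgradient
    exact ⟨hrun.integrable_comp_output hτ hF₂.1.2.continuous.norm,
      hgradient.trans (by gcongr; linarith),
      hrun.integrable_comp_output hτ (hF₂.continuous_lambdaMin_hessian (by lia) hδ),
      (neg_le_neg (by gcongr; linarith)).trans hcurvature⟩
  · have hlog := Real.log_natCast_nonneg n
    have hgap₀ : 0 ≤ initialGap F x₀ := sub_nonneg.2 (ciInf_le hbdd x₀)
    exact (sampleCount_le hε hε₁ hgap hm₁ hm₂ hT).trans (by gcongr; linarith)
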